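/- Pairwise Mutual Colorability (PMC) is the following problem. Input: a finite simple undirected graph $G=(V,E)$, an integer $k\ge 0$, and a set $\mathcal F$ of pairs of distinct non-adjacent vertices of $G$. Output: an assignment to every vertex $v$ of a set $A(v)\subseteq\{1,\dots,k\}$ of colors such that (1) $A(v)\neq\emptyset$ for every $v\in V$, (2) $A(x)\cap A(y)=\emptyset$ for every edge $\{x,y\}\in E$, and (3) $A(x)\cap A(y)\neq\emptyset$ for every pair $\{x,y\}\in\mathcal F$, if such an assignment exists; otherwise NO. Let $n=|V|$ and let $\alpha$ be the independence number of $G$, i.e. the size of a largest independent set. Then PMC, parameterized by $\alpha$ and $k$, has a fixed-parameter tractable algorithm running in $2^{\alpha k\log_2 k}\,n^{O(1)}$ time. That is, there are a single deterministic random access machine program (running time measured by the logarithmic cost criterion, graph and pairs given by their $n\times n$ matrices; $\alpha$ is not part of the input) and a constant $C$ such that on every instance $(G,k,\mathcal F)$ the program halts with a correct output after time at most $C\cdot 2^{\alpha k\log_2 k}\,(n+1)^{C}$, where $0\log_2 0=0$. -/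

import Mathlib

namespace RAM

/-- A memory state of a random access machine: registers `reg r`, and random access memories
(arrays) `arr a`, whose cells `arr a x` are addressed by natural numbers. A program mentions only
finitely many registers and arrays; arrays can be addressed indirectly, through registers. -/
@[ext] structure State where
  reg : ℕ → ℕ
  arr : ℕ → ℕ → ℕ

namespace State

/-- Write the value `v` into register `r`. -/
def setReg (s : State) (r v : ℕ) : State :=
  { s with reg := Function.update s.reg r v }

/-- Write the value `v` into cell `x` of array `a`. -/
def setArr (s : State) (a x v : ℕ) : State :=
  { s with arr := Function.update s.arr a (Function.update (s.arr a) x v) }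

end State

/-- Programs of the random access machine (in structured form). All arguments are fixed numbers:
indices of registers or arrays, and in `const` the value. -/
inductive Program where
  /-- do nothing -/
  | skip : Program
  /-- `reg r := c` -/
  | const (r c : ℕ) : Program
  /-- `reg r := reg p + reg q` -/
  | add (r p q : ℕ) : Program
  /-- `reg r := reg p - reg q` (truncated at zero) -/
  | sub (r p q : ℕ) : Program
  /-- `reg r := reg p * reg q` -/
  | mul (r p q : ℕ) : Program
  /-- `reg r := arr a (reg p)` -/
  | load (r a p : ℕ) : Program
  /-- `arr a (reg p) := reg q` -/
  | store (a p q : ℕ) : Program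
  /-- sequential composition -/
  | seq (P Q : Program) : Program
  /-- run `P` if `reg r ≠ 0`, and `Q` otherwise -/
  | ite (r : ℕ) (P Q : Program) : Program
  /-- as long as `reg r ≠ 0`, run `P` -/
  | loop (r : ℕ) (P : Program) : Program

/-- `Exec P s s' t`: started in the state `s`, the program `P` terminates in the state `s'`, after
time `t`. Time is measured by the logarithmic cost criterion: every instruction and every test
costs one unit plus the bit lengths (`Nat.size`) of the numbers and addresses that it handles. -/
inductive Exec : Program → State → State → ℕ → Prop where
  | skip (s : State) : Exec .skip s s 1
  | const (s : State) (r c : ℕ) : Exec (.const r c) s (s.setReg r c) (1 + c.size)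
  | add (s : State) (r p q : ℕ) :
      Exec (.add r p q) s (s.setReg r (s.reg p + s.reg q))
        (1 + (s.reg p).size + (s.reg q).size)
  | sub (s : State) (r p q : ℕ) :
      Exec (.sub r p q) s (s.setReg r (s.reg p - s.reg q))
        (1 + (s.reg p).size + (s.reg q).size)
  | mul (s : State) (r p q : ℕ) :
      Exec (.mul r p q) s (s.setReg r (s.reg p * s.reg q))
        (1 + (s.reg p).size + (s.reg q).size)
  | load (s : State) (r a p : ℕ) :
      Exec (.load r a p) s (s.setReg r (s.arr a (s.reg p)))
        (1 + (s.reg p).size + (s.arr a (s.reg p)).size)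
  | store (s : State) (a p q : ℕ) :
      Exec (.store a p q) s (s.setArr a (s.reg p) (s.reg q))
        (1 + (s.reg p).size + (s.reg q).size)
  | seq {P Q : Program} {s s' s'' : State} {t t' : ℕ} (h : Exec P s s' t)
      (h' : Exec Q s' s'' t') : Exec (.seq P Q) s s'' (t + t')
  | ite_ne {r : ℕ} {P Q : Program} {s s' : State} {t : ℕ} (hr : s.reg r ≠ 0)
      (h : Exec P s s' t) : Exec (.ite r P Q) s s' (1 + (s.reg r).size + t)
  | ite_eq {r : ℕ} {P Q : Program} {s s' : State} {t : ℕ} (hr : s.reg r = 0)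
      (h : Exec Q s s' t) : Exec (.ite r P Q) s s' (1 + (s.reg r).size + t)
  | loop_ne {r : ℕ} {P : Program} {s s' s'' : State} {t t' : ℕ} (hr : s.reg r ≠ 0)
      (h : Exec P s s' t) (h' : Exec (.loop r P) s' s'' t') :
      Exec (.loop r P) s s'' (1 + (s.reg r).size + t + t')
  | loop_eq {r : ℕ} {P : Program} {s : State} (hr : s.reg r = 0) :
      Exec (.loop r P) s s (1 + (s.reg r).size)

/-- The machine is deterministic: result and running time are determined by the start. -/
theorem Exec.deterministic {P : Program} {s s₁ s₂ : State} {t₁ t₂ : ℕ}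
    (h₁ : Exec P s s₁ t₁) (h₂ : Exec P s s₂ t₂) : s₁ = s₂ ∧ t₁ = t₂ := by
  induction h₁ generalizing s₂ t₂ with
  | seq _ _ ih ih' =>
    cases h₂ with
    | seq g g' =>
      obtain ⟨rfl, rfl⟩ := ih g
      obtain ⟨rfl, rfl⟩ := ih' g'
      exact ⟨rfl, rfl⟩
  | ite_ne hr _ ih =>
    cases h₂ with
    | ite_ne _ g =>
      obtain ⟨rfl, rfl⟩ := ih g
      exact ⟨rfl, rfl⟩
    | ite_eq hr' _ => exact absurd hr' hr
  | ite_eq hr _ ih =>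
    cases h₂ with
    | ite_ne hr' _ => exact absurd hr hr'
    | ite_eq _ g =>
      obtain ⟨rfl, rfl⟩ := ih g
      exact ⟨rfl, rfl⟩
  | loop_ne hr _ _ ih ih' =>
    cases h₂ with
    | loop_ne _ g g' =>
      obtain ⟨rfl, rfl⟩ := ih g
      obtain ⟨rfl, rfl⟩ := ih' g'
      exact ⟨rfl, rfl⟩
    | loop_eq hr' => exact absurd hr' hr
  | loop_eq hr =>
    cases h₂ with
    | loop_ne hr' _ _ => exact absurd hr hr'
    | loop_eq _ => exact ⟨rfl, rfl⟩
  | _ => cases h₂; exact ⟨rfl, rfl⟩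

end RAM

namespace PMC

/-- `A` assigns to every vertex a set of colors from `k` available colors such that (1) each vertex
receives at least one color, (2) adjacent vertices share no color, and (3) each pair of vertices in
`F` shares at least one color. -/
structure IsColoring {V : Type*} (G : SimpleGraph V) (F : Set (Sym2 V)) {k : ℕ}
    (A : V → Finset (Fin k)) : Prop where
  nonempty : ∀ v, (A v).Nonempty
  disjoint : ∀ u v, G.Adj u v → Disjoint (A u) (A v)
  shared : ∀ u v, s(u, v) ∈ F → ∃ c, c ∈ A u ∧ c ∈ A v

open scoped Classical in
/-- The initial state that represents an instance: registers `0` and `1` hold the number `n` of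
vertices and the number `k`; arrays `0` and `1` hold, row by row, the `n × n` matrices with entries
in `{0, 1}` of the adjacency relation of `G` and of the set of pairs `F`; all else is zero. -/
noncomputable def input {n : ℕ} (G : SimpleGraph (Fin n)) (k : ℕ) (F : Set (Sym2 (Fin n))) :
    RAM.State where
  reg r := if r = 0 then n else if r = 1 then k else 0
  arr a x :=
    if a = 0 then (if ∃ i j : Fin n, x = i * n + j ∧ G.Adj i j then 1 else 0)
    else if a = 1 then (if ∃ i j : Fin n, x = i * n + j ∧ s(i, j) ∈ F then 1 else 0)
    else 0

/-- The assignment of colors that is stored, row by row, as an `n × k` matrix in array `2`: vertex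
`v` receives color `c` if and only if the entry in row `v` and column `c` is nonzero. -/
def output (n k : ℕ) (s : RAM.State) (v : Fin n) : Finset (Fin k) :=
  {c | s.arr 2 (v * k + c) ≠ 0}

/-- The final state `s` is a correct answer to the instance `(G, k, F)`: either register `0` holds
`1` (YES) and array `2` holds a solution, or register `0` holds `0` (NO) and there is no solution. -/
def IsAnswer {n : ℕ} (G : SimpleGraph (Fin n)) (k : ℕ) (F : Set (Sym2 (Fin n)))
    (s : RAM.State) : Prop :=
  (s.reg 0 = 1 ∧ IsColoring G F (output n k s)) ∨
    (s.reg 0 = 0 ∧ ¬ ∃ A : Fin n → Finset (Fin k), IsColoring G F A)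

end PMC

/-! Read nonemptiness of `A v` as a demand on the pair `(v, v)`: a solution is then a proper
assignment in which the two ends of every demand share a color. Start from the empty assignment. If
some demand `x, y` is unmet, branch over the colors `c` that no neighbor of `x` or `y` has, and add
`c` to both. Every solution above the current assignment lies above one of its children
(`exists_extend_le`), so no solution is lost.

Color classes of a proper assignment are independent sets, so with `K` colors there are at most `α *
K` incidences between vertices and colors (`Proper.total_le`), while each branching step adds at
least one (`total_lt_total_extend`). The search tree thus has depth at most `α * K` and branching
number at most `K`, which bounds its size by `(α * K + 1) * (max K 1) ^ (α * K)` (`treeSize_le`).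

Since `n * n` colors always suffice (`exists_isColoring_of_sq_le`), the search uses `K = min k (n *
n)`, and one visit costs a polynomial in `n` times the bit length of `k`. For `k ≤ n * n` that
length is polynomial in `n`; otherwise `K < k` leaves a spare factor `k` in `k ^ (α * k)` that
absorbs it (`visits_mul_size_le`).

On the machine, `Runs` gives a time quadratic in the weight, because numbers may grow by a bit per
unit of weight. This is harmless for polynomial subroutines but would square the size of the tree in
the main loop. `search_exec` therefore restarts the estimate at every visit from the fixed bit bound
`Layout.bdd`, and counts visits by the potential in `Searching`. -/

namespace RAM

/-! ### Bit bounds on the memory, and which cells a program can change. -/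

/-- Every number stored in the memory has at most `b` bits. -/
def State.Bdd (b : ℕ) (s : State) : Prop :=
  (∀ r, (s.reg r).size ≤ b) ∧ ∀ a x, (s.arr a x).size ≤ b

theorem State.Bdd.mono {b b' : ℕ} {s : State} (h : s.Bdd b) (hb : b ≤ b') : s.Bdd b' :=
  ⟨fun r => (h.1 r).trans hb, fun a x => (h.2 a x).trans hb⟩

theorem State.Bdd.setReg {b r v : ℕ} {s : State} (h : s.Bdd b) (hv : v.size ≤ b) :
    (s.setReg r v).Bdd b := by
  refine ⟨fun r' => ?_, h.2⟩
  by_cases hr : r' = r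
  · subst hr; simpa [State.setReg] using hv
  · simpa [State.setReg, Function.update_of_ne hr] using h.1 r'

theorem State.Bdd.setArr {b a x v : ℕ} {s : State} (h : s.Bdd b) (hv : v.size ≤ b) :
    (s.setArr a x v).Bdd b := by
  refine ⟨h.1, fun a' x' => ?_⟩
  by_cases ha : a' = a
  · subst ha
    by_cases hx : x' = x
    · subst hx; simpa [State.setArr] using hv
    · simpa [State.setArr, Function.update_of_ne hx] using h.2 a' x'
  · simpa [State.setArr, Function.update_of_ne ha] using h.2 a' x'

theorem State.reg_setReg (s : State) (r v r' : ℕ) :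
    (s.setReg r v).reg r' = if r' = r then v else s.reg r' := by
  simp [State.setReg, Function.update_apply]

theorem State.arr_setReg (s : State) (r v : ℕ) : (s.setReg r v).arr = s.arr := rfl

theorem State.reg_setArr (s : State) (a x v : ℕ) : (s.setArr a x v).reg = s.reg := rfl

theorem State.arr_setArr (s : State) (a x v a' x' : ℕ) :
    (s.setArr a x v).arr a' x' = if a' = a ∧ x' = x then v else s.arr a' x' := by
  by_cases ha : a' = a
  · subst ha; simp [State.setArr, Function.update_apply]
  · simp [State.setArr, ha]

namespace Program

/-- The program contains no instruction that writes into register `r`. -/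
def keepsReg (r : ℕ) : Program → Bool
  | .skip => true
  | .const r' _ => r != r'
  | .add r' _ _ => r != r'
  | .sub r' _ _ => r != r'
  | .mul r' _ _ => r != r'
  | .load r' _ _ => r != r'
  | .store _ _ _ => true
  | .seq P Q => P.keepsReg r && Q.keepsReg r
  | .ite _ P Q => P.keepsReg r && Q.keepsReg r
  | .loop _ P => P.keepsReg r

/-- The program contains no instruction that writes into array `a`. -/
def keepsArr (a : ℕ) : Program → Bool
  | .store a' _ _ => a != a'
  | .seq P Q => P.keepsArr a && Q.keepsArr a
  | .ite _ P Q => P.keepsArr a && Q.keepsArr a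
  | .loop _ P => P.keepsArr a
  | _ => true

/-- The program has no loops. -/
def straight : Program → Bool
  | .seq P Q => P.straight && Q.straight
  | .ite _ P Q => P.straight && Q.straight
  | .loop _ _ => false
  | _ => true

/-- The final state of a loop-free program. -/
def eval : Program → State → State
  | .skip, s => s
  | .const r c, s => s.setReg r c
  | .add r p q, s => s.setReg r (s.reg p + s.reg q)
  | .sub r p q, s => s.setReg r (s.reg p - s.reg q)
  | .mul r p q, s => s.setReg r (s.reg p * s.reg q)
  | .load r a p, s => s.setReg r (s.arr a (s.reg p))
  | .store a p q, s => s.setArr a (s.reg p) (s.reg q)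
  | .seq P Q, s => Q.eval (P.eval s)
  | .ite r P Q, s => if s.reg r = 0 then Q.eval s else P.eval s
  | .loop _ _, s => s

/-- The weight of the execution of a loop-free program: every instruction increases the bit
lengths of the stored numbers by at most its weight. -/
def weight : Program → State → ℕ
  | .const _ c, _ => 1 + c
  | .mul _ _ q, s => 1 + s.reg q
  | .seq P Q, s => P.weight s + Q.weight (P.eval s)
  | .ite r P Q, s => 1 + if s.reg r = 0 then Q.weight s else P.weight s
  | _, _ => 1

end Program

/-- The two states agree on all registers and arrays into which `P` does not write. -/
def Agree (P : Program) (s s' : State) : Prop :=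
  (∀ r, P.keepsReg r = true → s'.reg r = s.reg r) ∧
    ∀ a, P.keepsArr a = true → s'.arr a = s.arr a

theorem Agree.refl (P : Program) (s : State) : Agree P s s := ⟨fun _ _ => rfl, fun _ _ => rfl⟩

theorem Agree.trans {P : Program} {s s' s'' : State} (h : Agree P s s') (h' : Agree P s' s'') :
    Agree P s s'' :=
  ⟨fun r hr => (h'.1 r hr).trans (h.1 r hr), fun a ha => (h'.2 a ha).trans (h.2 a ha)⟩

theorem Agree.mono {P Q : Program} {s s' : State} (h : Agree P s s')
    (hr : ∀ r, Q.keepsReg r = true → P.keepsReg r = true)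
    (ha : ∀ a, Q.keepsArr a = true → P.keepsArr a = true) : Agree Q s s' :=
  ⟨fun r h' => h.1 r (hr r h'), fun a h' => h.2 a (ha a h')⟩

theorem Agree.setReg {P : Program} {r : ℕ} (hr : P.keepsReg r = false) (s : State) (v : ℕ) :
    Agree P s (s.setReg r v) := by
  refine ⟨fun r' h' => ?_, fun _ _ => rfl⟩
  have : r' ≠ r := by rintro rfl; simp [hr] at h'
  simp [State.reg_setReg, this]

/-- The frame rule. As `keepsReg` and `keepsArr` compute, that a concrete program preserves a
concrete register or array is proved by `rfl`. -/
theorem Exec.agree {P : Program} {s s' : State} {t : ℕ} (h : Exec P s s' t) : Agree P s s' := by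
  induction h with
  | skip s => exact Agree.refl _ _
  | const | add | sub | mul | load => exact Agree.setReg (by simp [Program.keepsReg]) _ _
  | store s a p q =>
    refine ⟨fun _ _ => rfl, fun a' h' => ?_⟩
    have : a' ≠ a := by simpa [Program.keepsArr] using h'
    simp [State.setArr, this]
  | seq _ _ ih ih' =>
    exact (ih.mono (by simp +contextual [Program.keepsReg])
      (by simp +contextual [Program.keepsArr])).trans
      (ih'.mono (by simp +contextual [Program.keepsReg]) (by simp +contextual [Program.keepsArr]))
  | ite_ne _ _ ih =>
    exact ih.mono (by simp +contextual [Program.keepsReg]) (by simp +contextual [Program.keepsArr])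
  | ite_eq _ _ ih =>
    exact ih.mono (by simp +contextual [Program.keepsReg]) (by simp +contextual [Program.keepsArr])
  | loop_ne _ _ _ ih ih' =>
    exact (ih.mono (by simp [Program.keepsReg]) (by simp [Program.keepsArr])).trans ih'
  | loop_eq _ => exact Agree.refl _ _

/-! ### Cost-aware rules for total correctness. -/

/-- Started in `s`, the program `P` terminates in a state that satisfies `Q`, and its weight is at
most `T`: if the numbers in memory have at most `b` bits at the start, then they have at most
`b + T` bits at the end, and the running time is at most `T * (3 + 2 * (b + T))`. -/
def Runs (P : Program) (s : State) (T : ℕ) (Q : State → Prop) : Prop :=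
  ∃ s' t, Exec P s s' t ∧ Q s' ∧
    ∀ b, s.Bdd b → t ≤ T * (3 + 2 * (b + T)) ∧ s'.Bdd (b + T)

theorem Runs.imp {P : Program} {s : State} {T T' : ℕ} {Q Q' : State → Prop} (h : Runs P s T Q)
    (hT : T ≤ T') (hQ : ∀ s', Agree P s s' → Q s' → Q' s') : Runs P s T' Q' := by
  obtain ⟨s', t, he, hq, hb⟩ := h
  refine ⟨s', t, he, hQ s' he.agree hq, fun b h => ⟨(hb b h).1.trans ?_, (hb b h).2.mono ?_⟩⟩
  · gcongr
  · omega

/-- The second program starts with numbers of `b + T` bits. Weights simply add up because both time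
bounds are dominated by those with the final length `b + (T + T')`. -/
theorem Runs.seq {P P' : Program} {s : State} {T T' : ℕ} {Q R : State → Prop}
    (h : Runs P s T Q) (h' : ∀ s', Agree P s s' → Q s' → Runs P' s' T' R) :
    Runs (.seq P P') s (T + T') R := by
  obtain ⟨s', t, he, hq, hb⟩ := h
  obtain ⟨s'', t', he', hr, hb'⟩ := h' s' he.agree hq
  refine ⟨s'', t + t', he.seq he', hr, fun b h => ?_⟩
  obtain ⟨h1, h2⟩ := hb b h
  obtain ⟨h3, h4⟩ := hb' _ h2
  refine ⟨?_, h4.mono (by omega)⟩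
  calc t + t' ≤ T * (3 + 2 * (b + T)) + T' * (3 + 2 * (b + T + T')) := add_le_add h1 h3
    _ ≤ T * (3 + 2 * (b + (T + T'))) + T' * (3 + 2 * (b + (T + T'))) :=
      add_le_add (Nat.mul_le_mul_left _ (by omega)) (Nat.mul_le_mul_left _ (by omega))
    _ = _ := by ring

theorem Runs.ite {P P' : Program} {r : ℕ} {s : State} {T : ℕ} {Q : State → Prop}
    (h : s.reg r ≠ 0 → Runs P s T Q) (h' : s.reg r = 0 → Runs P' s T Q) :
    Runs (.ite r P P') s (1 + T) Q := by
  have key : ∀ b t, s.Bdd b → t ≤ T * (3 + 2 * (b + T)) →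
      1 + (s.reg r).size + t ≤ (1 + T) * (3 + 2 * (b + (1 + T))) := by
    intro b t hs ht
    have := hs.1 r
    nlinarith
  by_cases hr : s.reg r = 0
  · obtain ⟨s', t, he, hq, hb⟩ := h' hr
    exact ⟨s', _, .ite_eq hr he, hq, fun b hs =>
      ⟨key b t hs (hb b hs).1, (hb b hs).2.mono (by omega)⟩⟩
  · obtain ⟨s', t, he, hq, hb⟩ := h hr
    exact ⟨s', _, .ite_ne hr he, hq, fun b hs =>
      ⟨key b t hs (hb b hs).1, (hb b hs).2.mono (by omega)⟩⟩

theorem size_le_self (x : ℕ) : x.size ≤ x := Nat.size_le.2 Nat.lt_two_pow_self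

theorem size_mul_le (x y : ℕ) : (x * y).size ≤ x.size + y.size := by
  rw [Nat.size_le, pow_add]
  exact Nat.mul_lt_mul'' (Nat.lt_size_self x) (Nat.lt_size_self y)

theorem size_add_le (x y : ℕ) : (x + y).size ≤ max x.size y.size + 1 := by
  rw [Nat.size_le, pow_succ]
  have hx := (Nat.lt_size_self x).trans_le (Nat.pow_le_pow_right two_pos (le_max_left x.size y.size))
  have hy := (Nat.lt_size_self y).trans_le (Nat.pow_le_pow_right two_pos (le_max_right x.size y.size))
  omega

/-- Loop-free code is handled by symbolic evaluation. An addition gains at most one bit; a product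
gains at most the bit length of its second factor, which `weight` bounds crudely by the factor
itself. -/
theorem Runs.straight {P : Program} {s : State} {T : ℕ} {Q : State → Prop}
    (h : P.straight = true) (hT : P.weight s ≤ T) (hQ : Q (P.eval s)) : Runs P s T Q := by
  suffices H : ∀ (P : Program) (s : State), P.straight = true →
      Runs P s (P.weight s) (fun s' => s' = P.eval s) from
    (H P s h).imp hT (by rintro _ - rfl; exact hQ)
  clear hQ hT h
  intro P
  induction P with
  | skip =>
    exact fun s _ => ⟨s, 1, .skip s, rfl, fun b h => ⟨by simp only [Program.weight]; omega, h.mono (by omega)⟩⟩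
  | const r c =>
    intro s _
    have hc := size_le_self c
    refine ⟨_, _, .const s r c, rfl, fun b h => ⟨?_, (h.mono (by omega)).setReg ?_⟩⟩ <;>
      simp only [Program.weight]
    · nlinarith
    · omega
  | add r p q =>
    intro s _
    refine ⟨_, _, .add s r p q, rfl, fun b h => ⟨?_, (h.mono (by omega)).setReg ?_⟩⟩ <;>
      simp only [Program.weight] <;> have := h.1 p <;> have := h.1 q
    · omega
    · have := size_add_le (s.reg p) (s.reg q)
      omega
  | sub r p q =>
    intro s _
    refine ⟨_, _, .sub s r p q, rfl, fun b h => ⟨?_, (h.mono (by omega)).setReg ?_⟩⟩ <;>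
      simp only [Program.weight] <;> have := h.1 p <;> have := h.1 q
    · omega
    · have := Nat.size_le_size (Nat.sub_le (s.reg p) (s.reg q))
      omega
  | mul r p q =>
    intro s _
    refine ⟨_, _, .mul s r p q, rfl, fun b h => ⟨?_, (h.mono (by omega)).setReg ?_⟩⟩ <;>
      simp only [Program.weight] <;> have := h.1 p <;> have := h.1 q
    · nlinarith
    · have := size_mul_le (s.reg p) (s.reg q)
      have := size_le_self (s.reg q)
      omega
  | load r a p =>
    intro s _
    refine ⟨_, _, .load s r a p, rfl, fun b h => ⟨?_, (h.mono (by omega)).setReg ?_⟩⟩ <;>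
      simp only [Program.weight] <;> have := h.1 p <;> have := h.2 a (s.reg p) <;> omega
  | store a p q =>
    intro s _
    refine ⟨_, _, .store s a p q, rfl, fun b h => ⟨?_, (h.mono (by omega)).setArr ?_⟩⟩ <;>
      simp only [Program.weight] <;> have := h.1 p <;> have := h.1 q <;> omega
  | seq P P' ih ih' =>
    intro s h
    simp only [Program.straight, Bool.and_eq_true] at h
    exact (ih s h.1).seq (by rintro _ - rfl; exact ih' _ h.2)
  | ite r P P' ih ih' =>
    intro s h
    simp only [Program.straight, Bool.and_eq_true] at h
    refine Runs.ite (fun hr => ?_) (fun hr => ?_)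
    · simpa [Program.eval, hr] using ih s h.1
    · simpa [Program.eval, hr] using ih' s h.2
  | loop => exact fun s h => by simp [Program.straight] at h

/-- Run `P` with `reg i = 0, …, reg N - 1`, where register `4` holds the number `1`; register `d` is
used for the loop test. -/
def Program.forLoop (i d N : ℕ) (P : Program) : Program :=
  .seq (.const i 0) (.seq (.sub d N i) (.loop d (.seq P (.seq (.add i i 4) (.sub d N i)))))

/-- Register `d` counts the iterations left. The counters change after the body has established `I
(m + 1)`, so `hst` asks that `I` ignore them. Each round costs the body, two counter updates and a
test; the final `3` pays for two initializations and the last test. -/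
theorem Runs.forLoop {i d N : ℕ} {P : Program} {s₀ : State} {T : ℕ} (I : ℕ → State → Prop)
    (hP : (P.keepsReg i && P.keepsReg N && P.keepsReg 4) = true)
    (hd : (i != d && i != N && d != N && i != 4 && d != 4) = true)
    (h4 : s₀.reg 4 = 1) (h0 : I 0 s₀)
    (hst : ∀ m s x y, I m s → I m ((s.setReg i x).setReg d y))
    (hb : ∀ m s, m < s₀.reg N → Agree (.forLoop i d N P) s₀ s → s.reg i = m → I m s →
      Runs P s T (I (m + 1))) :
    Runs (.forLoop i d N P) s₀ (s₀.reg N * (T + 3) + 3) (I (s₀.reg N)) := by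
  simp only [Bool.and_eq_true, bne_iff_ne, ne_eq] at hP hd
  obtain ⟨⟨hPi, hPN⟩, hP4⟩ := hP
  obtain ⟨⟨⟨⟨hid, hiN⟩, hdN⟩, hi4⟩, hd4⟩ := hd
  have hki : (Program.forLoop i d N P).keepsReg i = false := by
    simp [Program.forLoop, Program.keepsReg]
  have hkd : (Program.forLoop i d N P).keepsReg d = false := by
    simp [Program.forLoop, Program.keepsReg]
  have hkN : (Program.forLoop i d N P).keepsReg N = true := by
    simp [Program.forLoop, Program.keepsReg, hPN, Ne.symm hiN, Ne.symm hdN]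
  have hk4 : (Program.forLoop i d N P).keepsReg 4 = true := by
    simp [Program.forLoop, Program.keepsReg, hP4, Ne.symm hi4, Ne.symm hd4]
  -- Induction on the number `j` of remaining iterations, which is the content of `d`.
  have loop : ∀ j m s, m + j = s₀.reg N → Agree (.forLoop i d N P) s₀ s → s.reg i = m →
      s.reg d = j → I m s →
      Runs (.loop d (.seq P (.seq (.add i i 4) (.sub d N i)))) s (j * (T + 3) + 1)
        (I (s₀.reg N)) := by
    intro j
    induction j with
    | zero =>
      intro m s hm ha hi hdj hI
      refine ⟨s, _, .loop_eq hdj, by simpa [← hm] using hI, fun b hs => ⟨?_, hs.mono (by omega)⟩⟩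
      have := hs.1 d
      omega
    | succ j ih =>
      intro m s hm ha hi hdj hI
      have step : Runs (.seq P (.seq (.add i i 4) (.sub d N i))) s (T + 2)
          (fun s' => Agree (.forLoop i d N P) s₀ s' ∧ s'.reg i = m + 1 ∧ s'.reg d = j ∧
            I (m + 1) s') := by
        refine (hb m s (by omega) ha hi hI).seq fun s' ha' hI' => ?_
        have hA : Agree (.forLoop i d N P) s₀ s' := ha.trans (ha'.mono
          (by simp +contextual [Program.forLoop, Program.keepsReg])
          (by simp +contextual [Program.forLoop, Program.keepsArr]))
        refine Runs.straight rfl le_rfl ⟨?_, ?_, ?_, ?_⟩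
        · exact (hA.trans (Agree.setReg hki _ _)).trans (Agree.setReg hkd _ _)
        · simp [Program.eval, State.reg_setReg, hid, ha'.1 i hPi, hi, hA.1 4 hk4, h4]
        · simp only [Program.eval, State.reg_setReg, if_true, Ne.symm hiN, if_false,
            ha'.1 i hPi, hi, hA.1 4 hk4, h4, hA.1 N hkN]
          omega
        · exact hst _ _ _ _ hI'
      obtain ⟨s', t, he, ⟨h1, h2, h3, h5⟩, hb1⟩ := step
      obtain ⟨s'', t', he', hq, hb2⟩ := ih (m + 1) s' (by omega) h1 h2 h3 h5
      refine ⟨s'', _, .loop_ne (by omega) he he', hq, fun b hs => ?_⟩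
      obtain ⟨h6, h7⟩ := hb1 b hs
      obtain ⟨h8, h9⟩ := hb2 _ h7
      refine ⟨?_, h9.mono (by linarith)⟩
      have h10 := hs.1 d
      set W := j * (T + 3) + 1
      have hW : (j + 1) * (T + 3) + 1 = T + 2 + 1 + W := by simp only [W]; ring
      rw [hW]
      calc 1 + (s.reg d).size + t + t'
          ≤ 1 + b + (T + 2) * (3 + 2 * (b + (T + 2))) + W * (3 + 2 * (b + (T + 2) + W)) := by
            gcongr
        _ ≤ 1 * (3 + 2 * (b + (T + 2 + 1 + W))) + (T + 2) * (3 + 2 * (b + (T + 2 + 1 + W)))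
            + W * (3 + 2 * (b + (T + 2 + 1 + W))) :=
            add_le_add (add_le_add (by omega) (Nat.mul_le_mul_left _ (by omega)))
              (Nat.mul_le_mul_left _ (by omega))
        _ = _ := by ring
  have init : Runs (.const i 0) s₀ 1 (fun s => s = s₀.setReg i 0) :=
    Runs.straight rfl (by simp [Program.weight]) rfl
  have init' : Runs (.sub d N i) (s₀.setReg i 0) 1
      (fun s => s = (s₀.setReg i 0).setReg d (s₀.reg N)) :=
    Runs.straight rfl (by simp [Program.weight])
      (by simp [Program.eval, State.reg_setReg, Ne.symm hiN])
  refine Runs.imp (T := 1 + (1 + (s₀.reg N * (T + 3) + 1))) (Q := I (s₀.reg N))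
    (init.seq ?_) (by omega) (fun _ _ h => h)
  rintro _ - rfl
  refine init'.seq ?_
  rintro _ - rfl
  refine loop _ 0 _ (by omega) ((Agree.setReg hki _ _).trans (Agree.setReg hkd _ _)) ?_ ?_
    (hst _ _ _ _ h0) <;> simp [State.reg_setReg, hid]

end RAM

/-! ### Subroutines on matrices stored in the queue. -/

namespace PMC

open RAM RAM.Program

infixr:60 " ;; " => RAM.Program.seq

/-- Rows `u` and `v` of the `n × K` matrix that starts at address `b` have a common nonzero column. -/
def Shares (f : ℕ → ℕ) (K b u v : ℕ) : Prop :=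
  ∃ c < K, f (u * K + c + b) ≠ 0 ∧ f (v * K + c + b) ≠ 0

/-- Put into register `23` whether rows `reg 14` and `reg 16` of the matrix at `reg 9` share. -/
def shareTest : Program :=
  .const 23 0 ;; forLoop 18 19 2
    (.mul 20 14 2 ;; .add 20 20 18 ;; .add 20 20 9 ;; .load 21 3 20 ;;
      .mul 20 16 2 ;; .add 20 20 18 ;; .add 20 20 9 ;; .load 22 3 20 ;;
      .ite 21 (.ite 22 (.const 23 1) .skip) .skip)

theorem shareTest_runs (s : State) (h4 : s.reg 4 = 1) :
    Runs shareTest s (s.reg 2 * (2 * s.reg 2 + 20) + 4) (fun s' =>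
      s'.reg 23 ≠ 0 ↔ Shares (s.arr 3) (s.reg 2) (s.reg 9) (s.reg 14) (s.reg 16)) := by
  refine Runs.imp (Runs.seq (Q := fun s' => s' = s.setReg 23 0) (T := 1)
    (.straight rfl (by simp [weight]) rfl) ?_) (T := 1 + (s.reg 2 * (2 * s.reg 2 + 17 + 3) + 3))
    (by ring_nf; rfl) fun _ _ h => h
  rintro _ - rfl
  refine Runs.forLoop (s₀ := s.setReg 23 0) (fun m s' => s'.reg 23 ≠ 0 ↔
    ∃ c < m, s.arr 3 (s.reg 14 * s.reg 2 + c + s.reg 9) ≠ 0 ∧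
      s.arr 3 (s.reg 16 * s.reg 2 + c + s.reg 9) ≠ 0) rfl rfl h4 (by simp [State.reg_setReg]) ?_ ?_
  · intro m s x y h
    simpa [State.reg_setReg] using h
  · intro m s' hm ha hi hI
    have e2 : s'.reg 2 = s.reg 2 := ha.1 2 rfl
    have e9 : s'.reg 9 = s.reg 9 := ha.1 9 rfl
    have e14 : s'.reg 14 = s.reg 14 := ha.1 14 rfl
    have e16 : s'.reg 16 = s.reg 16 := ha.1 16 rfl
    have ea : s'.arr 3 = s.arr 3 := ha.2 3 rfl
    refine .straight rfl ?_ ?_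
    · simp [weight, eval, State.reg_setReg, State.arr_setReg, e2]
      split_ifs <;> omega
    · simp only [Nat.lt_succ_iff_lt_or_eq, or_and_right, exists_or, exists_eq_left]
      rw [← hI]
      simp only [eval, State.reg_setReg, State.arr_setReg, e2, e9, e14, e16, ea, hi]
      norm_num
      by_cases h1 : s.arr 3 (s.reg 14 * s.reg 2 + m + s.reg 9) = 0 <;>
        by_cases h2 : s.arr 3 (s.reg 16 * s.reg 2 + m + s.reg 9) = 0 <;>
        simp [h1, h2, State.reg_setReg]

/-- Search for a demand, that is, a pair `(i, j)` with a nonzero entry in array `1`, such that rows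
`i` and `j` of the matrix at `reg 9` do not share. -/
def findDemand : Program :=
  .const 13 0 ;; forLoop 14 15 0 (forLoop 16 17 0
    (.mul 20 14 0 ;; .add 20 20 16 ;; .load 21 1 20 ;;
      .ite 21 (shareTest ;; .ite 23 .skip (.const 13 1 ;; .add 11 14 25 ;; .add 12 16 25)) .skip))

/-- The scan does not stop at an unmet demand: a later one overwrites the pair in registers `11` and
`12`. Register `25` is zero, so that adding it amounts to copying a register. -/
theorem findDemand_runs (s : State) (h4 : s.reg 4 = 1) (h25 : s.reg 25 = 0) :
    Runs findDemand s
      (s.reg 0 * (s.reg 0 * (s.reg 0 + s.reg 2 * (2 * s.reg 2 + 20) + 20) + 6) + 4) (fun s' =>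
      (s'.reg 13 = 0 → ∀ i < s.reg 0, ∀ j < s.reg 0, s.arr 1 (i * s.reg 0 + j) ≠ 0 →
        Shares (s.arr 3) (s.reg 2) (s.reg 9) i j) ∧
      (s'.reg 13 ≠ 0 → s'.reg 11 < s.reg 0 ∧ s'.reg 12 < s.reg 0 ∧
        s.arr 1 (s'.reg 11 * s.reg 0 + s'.reg 12) ≠ 0 ∧
        ¬ Shares (s.arr 3) (s.reg 2) (s.reg 9) (s'.reg 11) (s'.reg 12))) := by
  set n := s.reg 0
  set K := s.reg 2
  refine Runs.imp (Runs.seq (Q := fun s' => s' = s.setReg 13 0) (T := 1)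
    (.straight rfl (by simp [weight]) rfl) ?_)
    (T := 1 + (n * (n * (n + K * (2 * K + 20) + 17 + 3) + 3 + 3) + 3))
    (by ring_nf; rfl) fun _ _ h => h
  rintro _ - rfl
  refine Runs.forLoop (s₀ := s.setReg 13 0) (fun m s' =>
      (s'.reg 13 = 0 → ∀ i < m, ∀ j < n, s.arr 1 (i * n + j) ≠ 0 →
        Shares (s.arr 3) K (s.reg 9) i j) ∧
      (s'.reg 13 ≠ 0 → s'.reg 11 < n ∧ s'.reg 12 < n ∧
        s.arr 1 (s'.reg 11 * n + s'.reg 12) ≠ 0 ∧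
        ¬ Shares (s.arr 3) K (s.reg 9) (s'.reg 11) (s'.reg 12)))
      rfl rfl h4 (by simp [State.reg_setReg]) ?_ ?_
  · intro m s x y h
    simpa [State.reg_setReg] using h
  · intro m s₁ hm ha hi hI
    have e0 : s₁.reg 0 = n := ha.1 0 rfl
    -- The inner invariant splits the demands checked so far into the full rows below `m` and the
    -- first `l` entries of row `m`.
    refine Runs.imp (Runs.forLoop (s₀ := s₁) (fun l s' =>
      (s'.reg 13 = 0 → (∀ i < m, ∀ j < n, s.arr 1 (i * n + j) ≠ 0 →
        Shares (s.arr 3) K (s.reg 9) i j) ∧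
        ∀ j < l, s.arr 1 (m * n + j) ≠ 0 → Shares (s.arr 3) K (s.reg 9) m j) ∧
      (s'.reg 13 ≠ 0 → s'.reg 11 < n ∧ s'.reg 12 < n ∧
        s.arr 1 (s'.reg 11 * n + s'.reg 12) ≠ 0 ∧
        ¬ Shares (s.arr 3) K (s.reg 9) (s'.reg 11) (s'.reg 12)))
      (T := n + K * (2 * K + 20) + 17)
      rfl rfl ((ha.1 4 rfl).trans h4) ?_ ?_ ?_) (by simp only [e0]; omega) ?_
    · simpa [n] using hI
    · intro m s x y h
      simpa [State.reg_setReg] using h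
    · intro l s₂ hl ha₂ hj hJ
      have f0 : s₂.reg 0 = n := (ha₂.1 0 rfl).trans e0
      have f1 : s₂.arr 1 = s.arr 1 := (ha₂.2 1 rfl).trans (ha.2 1 rfl)
      have f14 : s₂.reg 14 = m := (ha₂.1 14 rfl).trans hi
      refine Runs.imp (T := (1 + n) + (1 + (1 + (1 + (K * (2 * K + 20) + 4 + 5)))))
        (Runs.seq (Q := fun s' => s' = s₂.setReg 20 (m * n)) (.straight rfl
        (by simp [weight, f0]) (by simp [eval, f0, f14])) ?_) (by omega) fun _ _ h => h
      rintro _ - rfl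
      refine Runs.seq (Q := fun s' => s' = (s₂.setReg 20 (m * n)).setReg 20 (m * n + l))
        (.straight rfl (by simp [weight]) (by simp [eval, State.reg_setReg, hj])) ?_
      rintro _ - rfl
      refine Runs.seq (Q := fun s' => s' =
        ((s₂.setReg 20 (m * n)).setReg 20 (m * n + l)).setReg 21 (s.arr 1 (m * n + l)))
        (.straight rfl (by simp [weight]) (by simp [eval, State.reg_setReg, State.arr_setReg, f1]))
        ?_
      rintro _ - rfl
      refine Runs.ite (fun h21 => ?_) (fun h21 => ?_)
      · refine Runs.imp (T := (K * (2 * K + 20) + 4) + 5) (Runs.seq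
          (Runs.imp (shareTest_runs _ ?_) ?_ (fun s' _ h => h)) ?_) le_rfl fun _ _ h => h
        · simpa [State.reg_setReg] using (ha₂.1 4 rfl).trans ((ha.1 4 rfl).trans h4)
        · simp only [State.reg_setReg]
          have : s₂.reg 2 = K := (ha₂.1 2 rfl).trans (ha.1 2 rfl)
          simp [this]
        · intro s₃ ha₃ hs
          have g2 : s₂.reg 2 = K := (ha₂.1 2 rfl).trans (ha.1 2 rfl)
          have g9 : s₂.reg 9 = s.reg 9 := (ha₂.1 9 rfl).trans (ha.1 9 rfl)
          have g3 : s₂.arr 3 = s.arr 3 := (ha₂.2 3 rfl).trans (ha.2 3 rfl)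
          have g11 : s₃.reg 11 = s₂.reg 11 := (ha₃.1 11 rfl)
          have g12 : s₃.reg 12 = s₂.reg 12 := (ha₃.1 12 rfl)
          have g13 : s₃.reg 13 = s₂.reg 13 := (ha₃.1 13 rfl)
          have g14 : s₃.reg 14 = m := (ha₃.1 14 rfl).trans f14
          have g16 : s₃.reg 16 = l := (ha₃.1 16 rfl).trans hj
          have g25 : s₃.reg 25 = 0 := (ha₃.1 25 rfl).trans ((ha₂.1 25 rfl).trans
            ((ha.1 25 rfl).trans h25))
          simp only [State.reg_setReg, State.arr_setReg, g2, g9, g3, f14, hj] at hs h21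
          norm_num at hs h21
          refine .straight rfl (by simp only [weight]; split_ifs <;> omega) ?_
          simp only [eval]
          by_cases h : s₃.reg 23 = 0
          · have hns : ¬ Shares (s.arr 3) K (s.reg 9) m l := fun h' => (hs.2 h') h
            simp only [h, if_true, State.reg_setReg, g14, g16, g25]
            norm_num
            exact ⟨hm, e0 ▸ hl, h21, hns⟩
          · have hsh := hs.1 h
            simp only [h, if_false, g11, g12, g13]
            refine ⟨fun h' => ⟨(hJ.1 h').1, fun j hj' hd => ?_⟩, hJ.2⟩
            rcases Nat.lt_succ_iff_lt_or_eq.1 hj' with h'' | rfl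
            · exact (hJ.1 h').2 j h'' hd
            · exact hsh
      · refine .straight rfl (by simp [weight]) ?_
        simp only [State.reg_setReg, if_true] at h21
        simp only [eval, State.reg_setReg]
        norm_num
        refine ⟨fun h' => ⟨(hJ.1 h').1, fun j hj' hd => ?_⟩, hJ.2⟩
        rcases Nat.lt_succ_iff_lt_or_eq.1 (Nat.lt_succ_of_le hj') with h'' | rfl
        · exact (hJ.1 h').2 j h'' hd
        · exact absurd h21 hd
    · rintro s' - ⟨h1, h2⟩
      refine ⟨fun h i him => ?_, h2⟩
      rcases Nat.lt_succ_iff_lt_or_eq.1 him with h'' | rfl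
      · exact (h1 h).1 i h''
      · rw [e0] at h1
        exact (h1 h).2

/-- Put into register `23` whether the column `reg 18` of the matrix at `reg 9` has a nonzero entry
in the row of some neighbor of `reg 11` or `reg 12`. -/
def conflictTest : Program :=
  .const 23 0 ;; forLoop 14 15 0
    (.mul 20 14 2 ;; .add 20 20 18 ;; .add 20 20 9 ;; .load 21 3 20 ;;
      .mul 20 11 0 ;; .add 20 20 14 ;; .load 22 0 20 ;;
      .mul 20 12 0 ;; .add 20 20 14 ;; .load 24 0 20 ;;
      .ite 21 (.ite 22 (.const 23 1) (.ite 24 (.const 23 1) .skip)) .skip)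

/-- Some neighbor of `x` or `y` has a nonzero entry in column `c`. -/
def Conflict (g f : ℕ → ℕ) (n K b x y c : ℕ) : Prop :=
  ∃ v < n, f (v * K + c + b) ≠ 0 ∧ (g (x * n + v) ≠ 0 ∨ g (y * n + v) ≠ 0)

theorem conflictTest_runs (s : State) (h4 : s.reg 4 = 1) :
    Runs conflictTest s (s.reg 0 * (s.reg 2 + 2 * s.reg 0 + 23) + 4) (fun s' =>
      s'.reg 23 ≠ 0 ↔ Conflict (s.arr 0) (s.arr 3) (s.reg 0) (s.reg 2) (s.reg 9) (s.reg 11)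
        (s.reg 12) (s.reg 18)) := by
  refine Runs.imp (Runs.seq (Q := fun s' => s' = s.setReg 23 0) (T := 1)
    (.straight rfl (by simp [weight]) rfl) ?_)
    (T := 1 + (s.reg 0 * (s.reg 2 + 2 * s.reg 0 + 20 + 3) + 3))
    (by ring_nf; rfl) fun _ _ h => h
  rintro _ - rfl
  refine Runs.forLoop (s₀ := s.setReg 23 0) (fun m s' => s'.reg 23 ≠ 0 ↔
    ∃ v < m, s.arr 3 (v * s.reg 2 + s.reg 18 + s.reg 9) ≠ 0 ∧
      (s.arr 0 (s.reg 11 * s.reg 0 + v) ≠ 0 ∨ s.arr 0 (s.reg 12 * s.reg 0 + v) ≠ 0))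
    rfl rfl h4 (by simp [State.reg_setReg]) ?_ ?_
  · intro m s x y h
    simpa [State.reg_setReg] using h
  · intro m s' hm ha hi hI
    have e0 : s'.reg 0 = s.reg 0 := ha.1 0 rfl
    have e2 : s'.reg 2 = s.reg 2 := ha.1 2 rfl
    have e9 : s'.reg 9 = s.reg 9 := ha.1 9 rfl
    have e11 : s'.reg 11 = s.reg 11 := ha.1 11 rfl
    have e12 : s'.reg 12 = s.reg 12 := ha.1 12 rfl
    have e18 : s'.reg 18 = s.reg 18 := ha.1 18 rfl
    have ea : s'.arr 3 = s.arr 3 := ha.2 3 rfl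
    have ea0 : s'.arr 0 = s.arr 0 := ha.2 0 rfl
    refine .straight rfl ?_ ?_
    · simp [weight, eval, State.reg_setReg, State.arr_setReg, e2, e0]
      split_ifs <;> omega
    · simp only [Nat.lt_succ_iff_lt_or_eq, or_and_right, exists_or, exists_eq_left]
      rw [← hI]
      simp only [eval, State.reg_setReg, State.arr_setReg, e0, e2, e9, e11, e12, e18, ea, ea0, hi]
      norm_num
      by_cases h1 : s.arr 3 (m * s.reg 2 + s.reg 18 + s.reg 9) = 0 <;>
        by_cases h2 : s.arr 0 (s.reg 11 * s.reg 0 + m) = 0 <;>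
        by_cases h3 : s.arr 0 (s.reg 12 * s.reg 0 + m) = 0 <;>
        simp [h1, h2, h3, State.reg_setReg]

/-- Copy the matrix at `reg 9` to the end `reg 6` of the queue, and set the entries of rows `reg 11`
and `reg 12` in column `reg 18` to one. -/
def push : Program :=
  .mul 10 6 3 ;;
  forLoop 16 17 3 (.add 20 9 16 ;; .load 21 3 20 ;; .add 20 10 16 ;; .store 3 20 21) ;;
  .mul 20 11 2 ;; .add 20 20 18 ;; .add 20 20 10 ;; .store 3 20 4 ;;
  .mul 20 12 2 ;; .add 20 20 18 ;; .add 20 20 10 ;; .store 3 20 4 ;; .add 6 6 4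

/-- The contents of array `3` after `push`. -/
def pushed (f : ℕ → ℕ) (K m h t x y c : ℕ) (a : ℕ) : ℕ :=
  if a = x * K + c + t * m ∨ a = y * K + c + t * m then 1
  else if t * m ≤ a ∧ a < t * m + m then f (h + (a - t * m)) else f a

/-- By `hh` the source block ends before the target block begins, so copying never overwrites a cell
still to be read. -/
theorem push_runs (s : State) (h4 : s.reg 4 = 1) (hh : s.reg 9 + s.reg 3 ≤ s.reg 6 * s.reg 3) :
    Runs push s (8 * s.reg 3 + 2 * s.reg 2 + 13) (fun s' =>
      s'.arr 3 = pushed (s.arr 3) (s.reg 2) (s.reg 3) (s.reg 9) (s.reg 6) (s.reg 11) (s.reg 12)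
        (s.reg 18) ∧ s'.reg 6 = s.reg 6 + 1) := by
  refine Runs.imp (Runs.seq (Q := fun s' => s' = s.setReg 10 (s.reg 6 * s.reg 3))
    (.straight rfl (T := 1 + s.reg 3) (by simp [weight]) rfl) ?_)
    (T := 1 + s.reg 3 + ((s.reg 3 * (4 + 3) + 3) + (2 * s.reg 2 + 9)))
    (by omega) fun _ _ h => h
  rintro _ - rfl
  refine Runs.seq (Runs.forLoop (s₀ := s.setReg 10 (s.reg 6 * s.reg 3)) (T := 4) (fun l s' =>
    s'.arr 3 = fun a => if s.reg 6 * s.reg 3 ≤ a ∧ a < s.reg 6 * s.reg 3 + l then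
      s.arr 3 (s.reg 9 + (a - s.reg 6 * s.reg 3)) else s.arr 3 a) rfl rfl h4 ?_ ?_ ?_) ?_
  · funext a
    have : ¬ (s.reg 6 * s.reg 3 ≤ a ∧ a < s.reg 6 * s.reg 3) := by omega
    simp [State.arr_setReg, this]
  · intro m s x y h
    simpa [State.arr_setReg] using h
  · intro l s' hl ha hi hI
    have e9 : s'.reg 9 = s.reg 9 := ha.1 9 rfl
    have e10 : s'.reg 10 = s.reg 6 * s.reg 3 := by
      rw [ha.1 10 rfl]; simp [State.reg_setReg]
    have hl' : l < s.reg 3 := hl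
    refine .straight rfl (by simp [weight]) ?_
    funext a
    simp only [eval, State.reg_setReg, State.arr_setReg, State.arr_setArr, e9, e10, hi, hI]
    norm_num
    rcases lt_trichotomy a (s.reg 6 * s.reg 3 + l) with h | h | h
    · have h1 : a ≠ s.reg 6 * s.reg 3 + l := by omega
      have h2 : (a < s.reg 6 * s.reg 3 + l) ↔ (a < s.reg 6 * s.reg 3 + (l + 1)) := by omega
      simp only [h1, if_false, h2]
    · subst h
      -- The cell being read lies below the target block and still has its original content.
      have h1 : ¬ (s.reg 6 * s.reg 3 ≤ s.reg 9 + l) := by omega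
      have h2 : s.reg 6 * s.reg 3 + l - s.reg 6 * s.reg 3 = l := by omega
      have h3 : s.reg 6 * s.reg 3 + l < s.reg 6 * s.reg 3 + (l + 1) := by omega
      simp [h1, h3]
    · have h1 : a ≠ s.reg 6 * s.reg 3 + l := by omega
      have h2 : (a < s.reg 6 * s.reg 3 + l) ↔ (a < s.reg 6 * s.reg 3 + (l + 1)) := by omega
      simp only [h1, if_false, h2]
  · intro s' ha hI
    have e2 : s'.reg 2 = s.reg 2 := ha.1 2 rfl
    have e4 : s'.reg 4 = 1 := (ha.1 4 rfl).trans h4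
    have e6 : s'.reg 6 = s.reg 6 := ha.1 6 rfl
    have e11 : s'.reg 11 = s.reg 11 := ha.1 11 rfl
    have e12 : s'.reg 12 = s.reg 12 := ha.1 12 rfl
    have e18 : s'.reg 18 = s.reg 18 := ha.1 18 rfl
    have e10 : s'.reg 10 = s.reg 6 * s.reg 3 := by
      rw [ha.1 10 rfl]; simp [State.reg_setReg]
    refine .straight rfl ?_ ⟨?_, ?_⟩
    · simp only [weight, eval, State.reg_setReg, State.reg_setArr, e2]
      norm_num
      omega
    · funext a
      simp only [eval, State.reg_setReg, State.reg_setArr, State.arr_setReg, State.arr_setArr,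
        e2, e4, e10, e11, e12, e18, hI, pushed]
      norm_num
      split_ifs <;> simp_all [State.reg_setReg]
    · simp [eval, State.reg_setReg, State.reg_setArr, e4, e6]

end PMC

/-! ### Partial solutions, extensions and the size of the search tree. -/

namespace PMC

open RAM RAM.Program

/-- The `n × K` matrix that starts at address `b` of the memory `f`, as an assignment of colors. -/
def colors (f : ℕ → ℕ) (n K b : ℕ) (v : Fin n) : Finset (Fin K) :=
  {c | f (v * K + c + b) ≠ 0}

theorem mem_colors {f : ℕ → ℕ} {n K b : ℕ} {v : Fin n} {c : Fin K} :
    c ∈ colors f n K b v ↔ f (v * K + c + b) ≠ 0 := by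
  simp [colors]

theorem shares_iff {f : ℕ → ℕ} {n K b : ℕ} {u v : Fin n} :
    Shares f K b u v ↔ ∃ c, c ∈ colors f n K b u ∧ c ∈ colors f n K b v := by
  simp only [Shares, mem_colors]
  exact ⟨fun ⟨c, hc, h⟩ => ⟨⟨c, hc⟩, h⟩, fun ⟨c, h⟩ => ⟨c, c.2, h⟩⟩

theorem mul_add_lt {n K v c : ℕ} (hv : v < n) (hc : c < K) : v * K + c < n * K := by
  have := Nat.mul_le_mul_right K (Nat.succ_le_of_lt hv)
  rw [Nat.succ_mul] at this
  omega

theorem mul_add_inj {K u v c d : ℕ} (hc : c < K) (hd : d < K) :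
    u * K + c = v * K + d ↔ u = v ∧ c = d := by
  refine ⟨fun h => ?_, by rintro ⟨rfl, rfl⟩; rfl⟩
  have hK : 0 < K := by omega
  have h1 : u = v := by
    have := congrArg (· / K) h
    simpa [Nat.mul_comm _ K, Nat.mul_add_div hK, Nat.div_eq_of_lt hc, Nat.div_eq_of_lt hd]
      using this
  subst h1
  exact ⟨rfl, by omega⟩

section Math

variable {n K : ℕ} (G : SimpleGraph (Fin n))

/-- Adjacent vertices share no color. -/
def Proper (A : Fin n → Finset (Fin K)) : Prop :=
  ∀ u v, G.Adj u v → Disjoint (A u) (A v)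

/-- No neighbor of `x` or `y` has the color `c`. -/
def Fits (A : Fin n → Finset (Fin K)) (x y : Fin n) (c : Fin K) : Prop :=
  ∀ v, c ∈ A v → ¬ G.Adj x v ∧ ¬ G.Adj y v

/-- Give the color `c` to `x` and `y`. -/
def extend (A : Fin n → Finset (Fin K)) (x y : Fin n) (c : Fin K) (v : Fin n) : Finset (Fin K) :=
  if v = x ∨ v = y then insert c (A v) else A v

/-- The number of incidences between vertices and colors. -/
def total (A : Fin n → Finset (Fin K)) : ℕ := ∑ v, (A v).card

theorem mem_extend {A : Fin n → Finset (Fin K)} {x y : Fin n} {c : Fin K} {v : Fin n}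
    {c' : Fin K} : c' ∈ extend A x y c v ↔ c' ∈ A v ∨ (c' = c ∧ (v = x ∨ v = y)) := by
  unfold extend
  split_ifs with h <;> simp [h]
  tauto

variable {G}

/-- A new clash would involve `c` at `x` or `y`: `Fits` excludes it against old incidences, and
non-adjacency of `x` and `y` between the new ones. -/
theorem Proper.extend {A : Fin n → Finset (Fin K)} {x y : Fin n} {c : Fin K} (h : Proper G A)
    (hxy : ¬ G.Adj x y) (hc : Fits G A x y c) : Proper G (extend A x y c) := by
  intro u v huv
  rw [Finset.disjoint_left]
  intro d hu hv
  rw [mem_extend] at hu hv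
  rcases hu with hu | ⟨rfl, rfl | rfl⟩ <;> rcases hv with hv | ⟨hd, hv⟩
  · exact Finset.disjoint_left.1 (h u v huv) hu hv
  · subst hd
    rcases hv with rfl | rfl
    · exact (hc u hu).1 huv.symm
    · exact (hc u hu).2 huv.symm
  · exact (hc v hv).1 huv
  · rcases hv with rfl | rfl
    · exact huv.ne rfl
    · exact hxy huv
  · exact (hc v hv).2 huv
  · rcases hv with rfl | rfl
    · exact hxy huv.symm
    · exact huv.ne rfl

/-- Count incidences by color instead of by vertex: each color class is independent. -/
theorem Proper.total_le {A : Fin n → Finset (Fin K)} (h : Proper G A) :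
    total A ≤ G.indepNum * K := by
  have h1 : total A = ∑ c : Fin K, ({v | c ∈ A v} : Finset (Fin n)).card := by
    unfold total
    simp only [Finset.card_filter]
    rw [Finset.sum_comm]
    simp
  rw [h1]
  calc _ ≤ ∑ _c : Fin K, G.indepNum := by
        refine Finset.sum_le_sum fun c _ => SimpleGraph.IsIndepSet.card_le_indepNum ?_
        intro u hu v hv _ huv
        simp only [Finset.coe_filter, Finset.mem_univ, true_and, Set.mem_ofPred_eq] at hu hv
        exact Finset.disjoint_left.1 (h u v huv) hu hv
    _ = _ := by simp [mul_comm]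

/-- As `x` and `y` share no color, `c` is missing at one of them. For `x = y` the hypothesis says
that `A x` is empty. -/
theorem total_lt_total_extend {A : Fin n → Finset (Fin K)} {x y : Fin n} {c : Fin K}
    (hc : ¬ ∃ c, c ∈ A x ∧ c ∈ A y) : total A < total (extend A x y c) := by
  have hle : ∀ v, A v ⊆ extend A x y c v := fun v d hd => mem_extend.2 (.inl hd)
  refine Finset.sum_lt_sum (fun v _ => Finset.card_le_card (hle v)) ?_
  by_cases hx : c ∈ A x
  · refine ⟨y, Finset.mem_univ _, Finset.card_lt_card ⟨hle y, fun h => hc ⟨c, hx, h ?_⟩⟩⟩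
    exact mem_extend.2 (.inr ⟨rfl, .inr rfl⟩)
  · refine ⟨x, Finset.mem_univ _, Finset.card_lt_card ⟨hle x, fun h => hx (h ?_)⟩⟩
    exact mem_extend.2 (.inr ⟨rfl, .inl rfl⟩)

/-- Take for `c` a color that the solution `B` itself uses to meet the demand. No neighbor of `x` or
`y` has it in `B`, hence none has it in `A`. -/
theorem exists_extend_le {F : Set (Sym2 (Fin n))} {A B : Fin n → Finset (Fin K)} {x y : Fin n}
    (hB : IsColoring G F B) (hAB : ∀ v, A v ⊆ B v) (hxy : x = y ∨ s(x, y) ∈ F) :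
    ∃ c, Fits G A x y c ∧ ∀ v, extend A x y c v ⊆ B v := by
  obtain ⟨c, hx, hy⟩ : ∃ c, c ∈ B x ∧ c ∈ B y := by
    rcases hxy with rfl | h
    · obtain ⟨c, hc⟩ := hB.nonempty x
      exact ⟨c, hc, hc⟩
    · exact hB.shared x y h
  refine ⟨c, fun v hv => ⟨fun h => ?_, fun h => ?_⟩, fun v d hd => ?_⟩
  · exact Finset.disjoint_left.1 (hB.disjoint _ _ h) hx (hAB v hv)
  · exact Finset.disjoint_left.1 (hB.disjoint _ _ h) hy (hAB v hv)
  · rcases mem_extend.1 hd with hd | ⟨rfl, rfl | rfl⟩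
    exacts [hAB v hd, hx, hy]

/-- Reserve a private color `i * n + j` for each ordered pair, and give it to `i` and `j` exactly if
`i = j` or the pair is in `F`. A color class is then a vertex or a non-adjacent pair. -/
theorem exists_isColoring_of_sq_le {F : Set (Sym2 (Fin n))} (hF : F ⊆ Gᶜ.edgeSet)
    (hK : n * n ≤ K) : ∃ A : Fin n → Finset (Fin K), IsColoring G F A := by
  classical
  have hlt : ∀ i j : Fin n, i.1 * n + j < K := fun i j => (mul_add_lt i.2 j.2).trans_le hK
  refine ⟨fun v => {c | ∃ i j : Fin n, c.1 = i * n + j ∧ (i = j ∨ s(i, j) ∈ F) ∧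
    (v = i ∨ v = j)}, fun v => ⟨⟨v * n + v, hlt v v⟩, ?_⟩, fun u v huv => ?_, fun u v huv => ?_⟩
  · simp only [Finset.mem_filter, Finset.mem_univ, true_and]
    exact ⟨v, v, rfl, .inl rfl, .inl rfl⟩
  · rw [Finset.disjoint_left]
    intro c hc hc'
    simp only [Finset.mem_filter, Finset.mem_univ, true_and] at hc hc'
    obtain ⟨i, j, h1, h2, h3⟩ := hc
    obtain ⟨i', j', h4, h5, h6⟩ := hc'
    obtain ⟨h7, h8⟩ := (mul_add_inj j.2 j'.2).1 (h1.symm.trans h4)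
    obtain rfl := Fin.ext h7
    obtain rfl := Fin.ext h8
    rcases h2 with rfl | h2
    · rcases h3 with rfl | rfl <;> rcases h6 with h6 | h6 <;> exact huv.ne h6.symm
    · have hn : ¬ G.Adj i j := ((SimpleGraph.compl_adj _ _ _).1 (hF h2)).2
      rcases h3 with rfl | rfl <;> rcases h6 with rfl | rfl
      exacts [huv.ne rfl, hn huv, hn huv.symm, huv.ne rfl]
  · refine ⟨⟨u * n + v, hlt u v⟩, ?_, ?_⟩ <;>
      simp only [Finset.mem_filter, Finset.mem_univ, true_and]
    · exact ⟨u, v, rfl, .inr huv, .inl rfl⟩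
    · exact ⟨u, v, rfl, .inr huv, .inr rfl⟩

/-- The size of the search tree of branching number `K` and depth `l`. -/
def treeSize (K : ℕ) : ℕ → ℕ
  | 0 => 1
  | l + 1 => 1 + K * treeSize K l

theorem treeSize_pos (K l : ℕ) : 0 < treeSize K l := by
  cases l <;> simp only [treeSize] <;> omega

theorem treeSize_mono (K : ℕ) : Monotone (treeSize K) := by
  refine monotone_nat_of_le_succ fun l => ?_
  induction l with
  | zero => simp only [treeSize]; omega
  | succ l ih =>
    rw [treeSize, treeSize.eq_2 K (l + 1)]
    gcongr

/-- A crude bound, sufficient for the bit length of queue indices. -/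
theorem treeSize_le_two_pow (K l : ℕ) : treeSize K l ≤ 2 ^ (K * l) := by
  induction l with
  | zero => simp [treeSize]
  | succ l ih =>
    have := treeSize_pos K l
    have h2 : 1 + K ≤ 2 ^ K := by
      have := Nat.lt_two_pow_self (n := K)
      omega
    calc treeSize K (l + 1) ≤ (1 + K) * treeSize K l := by rw [treeSize]; nlinarith
      _ ≤ 2 ^ K * 2 ^ (K * l) := Nat.mul_le_mul h2 ih
      _ = _ := by rw [← pow_add]; ring_nf

/-- There are `l + 1` levels, each with at most `(max K 1) ^ l` nodes; the maximum accounts for the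
root when `K = 0`. -/
theorem treeSize_le (K l : ℕ) : treeSize K l ≤ (l + 1) * (max K 1) ^ l := by
  induction l with
  | zero => simp [treeSize]
  | succ l ih =>
    have h1 : 1 ≤ (max K 1) ^ (l + 1) := Nat.one_le_pow _ _ (by simp)
    calc treeSize K (l + 1) = 1 + K * treeSize K l := rfl
      _ ≤ (max K 1) ^ (l + 1) + max K 1 * ((l + 1) * (max K 1) ^ l) :=
        add_le_add h1 (Nat.mul_le_mul (le_max_left _ _) ih)
      _ = _ := by ring

end Math

theorem conflict_iff {n K : ℕ} {G : SimpleGraph (Fin n)} {g f : ℕ → ℕ} {b : ℕ} {x y : Fin n}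
    {c : Fin K} (hG : ∀ i j : Fin n, g (i * n + j) ≠ 0 ↔ G.Adj i j) :
    Conflict g f n K b x y c ↔ ¬ Fits G (colors f n K b) x y c := by
  simp only [Conflict, Fits, mem_colors]
  push Not
  constructor
  · rintro ⟨v, hv, h, h'⟩
    refine ⟨⟨v, hv⟩, h, fun h1 => ?_⟩
    rcases h' with h' | h'
    · exact absurd ((hG x ⟨v, hv⟩).1 h') h1
    · exact (hG y ⟨v, hv⟩).1 h'
  · rintro ⟨v, h, h'⟩
    refine ⟨v, v.2, h, ?_⟩
    rw [hG, hG]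
    tauto

theorem pushed_of_lt {f : ℕ → ℕ} {K m h t x y c a : ℕ} (ha : a < t * m) :
    pushed f K m h t x y c a = f a := by
  have h1 : ¬ (a = x * K + c + t * m ∨ a = y * K + c + t * m) := by omega
  have h2 : ¬ (t * m ≤ a ∧ a < t * m + m) := by omega
  simp [pushed, h1, h2]

theorem pushed_le_one {f : ℕ → ℕ} {K m h t x y c : ℕ} (hf : ∀ a, f a ≤ 1) (a : ℕ) :
    pushed f K m h t x y c a ≤ 1 := by
  unfold pushed
  split_ifs
  exacts [le_rfl, hf _, hf _]

theorem colors_pushed {f : ℕ → ℕ} {n K h t : ℕ} {x y : Fin n} {c : Fin K} :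
    colors (pushed f K (n * K) h t x y c) n K (t * (n * K)) =
      extend (colors f n K h) x y c := by
  funext v
  ext d
  have h1 := mul_add_lt v.2 d.2
  rw [mem_extend, mem_colors, mem_colors]
  have h2 : (v * K + d + t * (n * K) = x * K + c + t * (n * K) ∨
      v * K + d + t * (n * K) = y * K + c + t * (n * K)) ↔ d = c ∧ (v = x ∨ v = y) := by
    rw [add_left_inj, add_left_inj, mul_add_inj d.2 c.2, mul_add_inj d.2 c.2]
    simp only [Fin.ext_iff]
    tauto
  have h3 : t * (n * K) ≤ v * K + d + t * (n * K) ∧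
      v * K + d + t * (n * K) < t * (n * K) + n * K := by omega
  have h4 : h + (v * K + d + t * (n * K) - t * (n * K)) = v * K + d + h := by omega
  simp only [pushed, h2]
  rw [if_pos h3, h4]
  split_ifs with h5 <;> simp [h5]

/-- Block `i` occupies cells below `t * (n * K)`, so appending blocks from position `t` on does not
disturb it. -/
theorem colors_congr {f f' : ℕ → ℕ} {n K i t : ℕ} (hi : i < t)
    (h : ∀ a < t * (n * K), f' a = f a) :
    colors f' n K (i * (n * K)) = colors f n K (i * (n * K)) := by
  funext v
  ext d
  rw [mem_colors, mem_colors, h]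
  have h1 := mul_add_lt v.2 d.2
  have := Nat.mul_le_mul_right (n * K) (Nat.succ_le_of_lt hi)
  rw [Nat.succ_mul] at this
  omega

/-! ### Branching at one partial solution. -/

/-- Append to the queue all extensions of the matrix at `reg 9` by a color for `reg 11` and
`reg 12`. -/
def expand : Program :=
  forLoop 18 19 2 (conflictTest ;; .ite 23 .skip push)

theorem expand_runs {n K h t : ℕ} {G : SimpleGraph (Fin n)} {x y : Fin n} (s : State)
    (h4 : s.reg 4 = 1) (e0 : s.reg 0 = n) (e2 : s.reg 2 = K) (e3 : s.reg 3 = n * K)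
    (e6 : s.reg 6 = t) (e9 : s.reg 9 = h * (n * K)) (ht : h < t) (e11 : s.reg 11 = x)
    (e12 : s.reg 12 = y) (hG : ∀ i j : Fin n, s.arr 0 (i * n + j) ≠ 0 ↔ G.Adj i j)
    (h3 : ∀ a, s.arr 3 a ≤ 1) :
    Runs expand s (K * (n * (K + 2 * n + 23) + 8 * (n * K) + 2 * K + 21) + 3) (fun s' =>
      t ≤ s'.reg 6 ∧ s'.reg 6 ≤ t + K ∧ (∀ a < t * (n * K), s'.arr 3 a = s.arr 3 a) ∧
      (∀ a, s'.arr 3 a ≤ 1) ∧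
      (∀ i, t ≤ i → i < s'.reg 6 → ∃ c : Fin K,
        Fits G (colors (s.arr 3) n K (h * (n * K))) x y c ∧
        colors (s'.arr 3) n K (i * (n * K)) =
          extend (colors (s.arr 3) n K (h * (n * K))) x y c) ∧
      ∀ c : Fin K, Fits G (colors (s.arr 3) n K (h * (n * K))) x y c →
        ∃ i, t ≤ i ∧ i < s'.reg 6 ∧ colors (s'.arr 3) n K (i * (n * K)) =
          extend (colors (s.arr 3) n K (h * (n * K))) x y c) := by
  set A := colors (s.arr 3) n K (h * (n * K)) with hA
  refine Runs.imp (Runs.forLoop (s₀ := s)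
    (T := n * (K + 2 * n + 23) + 4 + (1 + (8 * (n * K) + 2 * K + 13)))
    (fun l s' =>
      t ≤ s'.reg 6 ∧ s'.reg 6 ≤ t + l ∧ (∀ a < t * (n * K), s'.arr 3 a = s.arr 3 a) ∧
      (∀ a, s'.arr 3 a ≤ 1) ∧
      (∀ i, t ≤ i → i < s'.reg 6 → ∃ c : Fin K, Fits G A x y c ∧
        colors (s'.arr 3) n K (i * (n * K)) = extend A x y c) ∧
      ∀ c : Fin K, c.1 < l → Fits G A x y c →
        ∃ i, t ≤ i ∧ i < s'.reg 6 ∧ colors (s'.arr 3) n K (i * (n * K)) = extend A x y c)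
    rfl rfl h4 ?_ ?_ ?_) ?_ ?_
  · exact ⟨e6.ge, e6.le, fun _ _ => rfl, h3, fun i h1 h2 => by omega,
      fun c hc => absurd hc (Nat.not_lt_zero _)⟩
  · intro m s x y h
    simpa [State.reg_setReg, State.arr_setReg] using h
  · rintro l s₁ hl ha hi ⟨i1, i2, i3, i4, i5, i6⟩
    rw [e2] at hl
    have f0 : s₁.reg 0 = n := (ha.1 0 rfl).trans e0
    have f2 : s₁.reg 2 = K := (ha.1 2 rfl).trans e2
    have f3 : s₁.reg 3 = n * K := (ha.1 3 rfl).trans e3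
    have f4 : s₁.reg 4 = 1 := (ha.1 4 rfl).trans h4
    have f9 : s₁.reg 9 = h * (n * K) := (ha.1 9 rfl).trans e9
    have f11 : s₁.reg 11 = x := (ha.1 11 rfl).trans e11
    have f12 : s₁.reg 12 = y := (ha.1 12 rfl).trans e12
    have g0 : s₁.arr 0 = s.arr 0 := ha.2 0 rfl
    -- The parent's block precedes all appended ones, so every child extends the same `A`.
    have hA₁ : colors (s₁.arr 3) n K (h * (n * K)) = A := colors_congr ht i3
    refine Runs.seq (Runs.imp (conflictTest_runs s₁ f4) (by simp only [f0, f2]; omega)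
      fun _ _ h => h) ?_
    intro s₂ ha₂ hs
    have g3 : s₂.arr 3 = s₁.arr 3 := ha₂.2 3 rfl
    have g6 : s₂.reg 6 = s₁.reg 6 := ha₂.1 6 rfl
    rw [f0, f2, f9, f11, f12, hi, show l = (⟨l, hl⟩ : Fin K).1 from rfl,
      conflict_iff (g0 ▸ hG), hA₁] at hs
    refine Runs.ite (fun h23 => ?_) (fun h23 => ?_)
    · refine .straight rfl (by simp [weight]) ?_
      simp only [eval, g3, g6]
      refine ⟨i1, by omega, i3, i4, i5, fun c hc hf => ?_⟩
      rcases Nat.lt_succ_iff_lt_or_eq.1 hc with hc | hc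
      · exact i6 c hc hf
      · subst hc
        exact absurd hf (hs.1 h23)
    · have hfit : Fits G A x y ⟨l, hl⟩ := by
        by_contra hcon
        exact hs.2 hcon h23
      have k2 : s₂.reg 2 = K := (ha₂.1 2 rfl).trans f2
      have k3 : s₂.reg 3 = n * K := (ha₂.1 3 rfl).trans f3
      have k9 : s₂.reg 9 = h * (n * K) := (ha₂.1 9 rfl).trans f9
      have hle : (h + 1) * (n * K) ≤ s₁.reg 6 * (n * K) := Nat.mul_le_mul_right _ (by omega)
      refine Runs.imp (push_runs s₂ ((ha₂.1 4 rfl).trans f4) ?_) (by simp only [k2, k3]; omega) ?_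
      · rw [k9, k3, g6, ← Nat.succ_mul]; exact hle
      · rintro s₃ - ⟨p1, p2⟩
        rw [g3, k2, k3, k9, g6, ha₂.1 11 rfl, f11, ha₂.1 12 rfl, f12, ha₂.1 18 rfl, hi] at p1
        rw [g6] at p2
        have hlt : ∀ a < s₁.reg 6 * (n * K), s₃.arr 3 a = s₁.arr 3 a := fun a ha => by
          rw [p1, pushed_of_lt ha]
        have hold : ∀ i < s₁.reg 6, colors (s₃.arr 3) n K (i * (n * K)) =
            colors (s₁.arr 3) n K (i * (n * K)) := fun i hi => colors_congr hi hlt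
        have hnew : colors (s₃.arr 3) n K (s₁.reg 6 * (n * K)) = extend A x y ⟨l, hl⟩ := by
          rw [p1, ← hA₁]
          exact colors_pushed (c := (⟨l, hl⟩ : Fin K))
        rw [p2]
        refine ⟨by omega, by omega, fun a ha => ?_, ?_, fun i hi hi' => ?_, fun c hc hf => ?_⟩
        · rw [hlt a (ha.trans_le (Nat.mul_le_mul_right _ i1)), i3 a ha]
        · rw [p1]; exact pushed_le_one i4
        · rcases Nat.lt_succ_iff_lt_or_eq.1 hi' with h' | rfl
          · rw [hold i h']; exact i5 i hi h'
          · exact ⟨_, hfit, hnew⟩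
        · rcases Nat.lt_succ_iff_lt_or_eq.1 hc with hc | hc
          · obtain ⟨i, q1, q2, q3⟩ := i6 c hc hf
            exact ⟨i, q1, by omega, by rw [hold i q2, q3]⟩
          · subst hc
            exact ⟨s₁.reg 6, i1, by omega, hnew⟩
  · rw [e2]
    ring_nf
    rfl
  · rintro s' - ⟨j1, j2, j3, j4, j5, j6⟩
    exact ⟨j1, e2 ▸ j2, j3, j4, j5, fun c hf => j6 c (e2 ▸ c.2) hf⟩

end PMC

/-! ### The search loop: invariant, potential and time. -/

namespace PMC

open RAM RAM.Program

section

variable {n : ℕ} (k K : ℕ) (G : SimpleGraph (Fin n)) (F : Set (Sym2 (Fin n)))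

/-- The bound for the number of partial solutions that the search visits. -/
noncomputable def visits : ℕ := treeSize K (G.indepNum * K)

/-- Properties of the state that hold whenever the search visits a partial solution. Registers: `0`
number of vertices, `1` number of colors, `2` number of colors in use, `3` size of a block, `4` one,
`5` head and `6` tail of the queue, `7` length of the queue, `8` success; the others are auxiliary.
Arrays: `0` adjacency, `1` demands, `2` output, `3` queue. -/
structure Layout (s : State) : Prop where
  reg_zero : s.reg 0 = n
  reg_one : s.reg 1 = k
  reg_two : s.reg 2 = K
  reg_three : s.reg 3 = n * K
  reg_four : s.reg 4 = 1
  head_le : s.reg 5 ≤ visits K G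
  tail_le : s.reg 6 ≤ visits K G
  length_le : s.reg 7 ≤ visits K G
  success_le : s.reg 8 ≤ 1
  reg_eq_zero : ∀ r, 9 ≤ r → s.reg r = 0
  adj : ∀ i j : Fin n, s.arr 0 (i * n + j) ≠ 0 ↔ G.Adj i j
  demand : ∀ i j : Fin n, s.arr 1 (i * n + j) ≠ 0 ↔ i = j ∨ s(i, j) ∈ F
  out : ∀ a, s.arr 2 a = 0
  arr_le : ∀ a x, s.arr a x ≤ 1

/-- The number of bits that suffice for the numbers in memory during the search. -/
noncomputable def width : ℕ := (n + K + n * K + 1 + visits K G).size + k.size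

variable {k K G F}

/-- A bit bound independent of the number of visits made so far. It needs queue positions bounded by
`visits` and the auxiliary registers reset, which is why every visit ends with `clear`. -/
theorem Layout.bdd {s : State} (h : Layout k K G F s) : s.Bdd (width k K G) := by
  have key : ∀ x, x ≤ n + K + n * K + 1 + visits K G → x.size ≤ width k K G := fun x hx =>
    (Nat.size_le_size hx).trans (Nat.le_add_right _ _)
  refine ⟨fun r => ?_, fun a x => key _ ((h.arr_le a x).trans (by omega))⟩
  have h5 := h.head_le
  have h6 := h.tail_le
  have h7 := h.length_le
  have h8 := h.success_le
  by_cases hr : 9 ≤ r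
  · rw [h.reg_eq_zero r hr]; exact key 0 (Nat.zero_le _)
  · interval_cases r
    · rw [h.reg_zero]; exact key _ (by omega)
    · rw [h.reg_one]; exact Nat.le_add_left _ _
    · rw [h.reg_two]; exact key _ (by omega)
    · rw [h.reg_three]; exact key _ (by omega)
    · rw [h.reg_four]; exact key _ (by omega)
    all_goals exact key _ (by omega)

variable (k K G F)

/-- The invariant of the search: all entries of the queue are proper, few more partial solutions
will be visited, and every solution extends an entry of the queue. -/
structure Searching (s : State) : Prop extends Layout k K G F s where
  length : s.reg 7 = s.reg 6 - s.reg 5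
  head_le_tail : s.reg 5 ≤ s.reg 6
  success : s.reg 8 = 0
  proper : ∀ i, s.reg 5 ≤ i → i < s.reg 6 → Proper G (colors (s.arr 3) n K (i * (n * K)))
  potential : s.reg 5 + ∑ i ∈ Finset.Ico (s.reg 5) (s.reg 6),
    treeSize K (G.indepNum * K - total (colors (s.arr 3) n K (i * (n * K)))) ≤ visits K G
  complete : ∀ B : Fin n → Finset (Fin K), IsColoring G F B → ∃ i, s.reg 5 ≤ i ∧ i < s.reg 6 ∧
    ∀ v, colors (s.arr 3) n K (i * (n * K)) v ⊆ B v

/-- The search has found a solution at the head of the queue. -/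
structure Found (s : State) : Prop extends Layout k K G F s where
  length : s.reg 7 = 0
  success : s.reg 8 = 1
  solution : IsColoring G F (colors (s.arr 3) n K (s.reg 5 * (n * K)))

end

/-- Set the auxiliary registers to zero. -/
def clear : Program :=
  .const 9 0 ;; .const 10 0 ;; .const 11 0 ;; .const 12 0 ;; .const 13 0 ;; .const 14 0 ;;
  .const 15 0 ;; .const 16 0 ;; .const 17 0 ;; .const 18 0 ;; .const 19 0 ;; .const 20 0 ;;
  .const 21 0 ;; .const 22 0 ;; .const 23 0 ;; .const 24 0

theorem clear_runs (s : State) : Runs clear s 16 (fun s' =>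
    s'.arr = s.arr ∧ (∀ r < 9, s'.reg r = s.reg r) ∧
      ∀ r, 9 ≤ r → (25 ≤ r → s.reg r = 0) → s'.reg r = 0) := by
  refine .straight rfl (by simp [clear, weight]) ⟨rfl, fun r hr => ?_, fun r hr h => ?_⟩
  · interval_cases r <;> simp [clear, eval, State.reg_setReg]
  · by_cases h25 : 25 ≤ r
    · rw [← h h25]
      have : ∀ i < 25, r ≠ i := by omega
      simp [clear, eval, State.reg_setReg, this]
    · interval_cases r <;> simp [clear, eval, State.reg_setReg]

/-- Visit the head of the queue. -/
def visit : Program :=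
  .mul 9 5 3 ;; findDemand ;;
  .ite 13 (expand ;; .add 5 5 4 ;; .sub 7 6 5) (.const 8 1 ;; .const 7 0) ;; clear

/-- A bound for the weight of `visit`. -/
def visitWeight (n K : ℕ) : ℕ :=
  1 + n * K + (n * (n * (n + K * (2 * K + 20) + 20) + 6) + 4) +
    (K * (n * (K + 2 * n + 23) + 8 * (n * K) + 2 * K + 21) + 10) + 16

theorem keepsReg_visit {r : ℕ} (h : 25 ≤ r) : visit.keepsReg r = true := by
  have : ∀ i < 25, r ≠ i := by omega
  simp [visit, findDemand, shareTest, expand, conflictTest, push, clear, forLoop, keepsReg, this]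

/-- The recursion of `treeSize` as an amortization: a node with `L - p` incidences to spare pays `1`
for its visit and passes the rest to at most `K` children, each with less to spare. -/
theorem one_add_sum_le {L K t t' p : ℕ} {q : ℕ → ℕ} (ht : t' ≤ t + K)
    (h : ∀ i, t ≤ i → i < t' → p < q i ∧ q i ≤ L) :
    1 + ∑ i ∈ Finset.Ico t t', treeSize K (L - q i) ≤ treeSize K (L - p) := by
  by_cases hlt : t < t'
  · have h0 := h t le_rfl hlt
    obtain ⟨l, hl⟩ : ∃ l, L - p = l + 1 := ⟨L - p - 1, by omega⟩
    rw [hl, treeSize]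
    gcongr
    calc _ ≤ ∑ _i ∈ Finset.Ico t t', treeSize K l := by
          refine Finset.sum_le_sum fun i hi => treeSize_mono K ?_
          rw [Finset.mem_Ico] at hi
          have := h i hi.1 hi.2
          omega
      _ = (t' - t) * treeSize K l := by simp
      _ ≤ K * treeSize K l := Nat.mul_le_mul_right _ (by omega)
  · rw [Finset.Ico_eq_empty hlt]
    simpa using Nat.one_le_iff_ne_zero.2 (treeSize_pos K (L - p)).ne'

section

variable {n : ℕ} {k K : ℕ} {G : SimpleGraph (Fin n)} {F : Set (Sym2 (Fin n))}

theorem visit_runs (hF : F ⊆ Gᶜ.edgeSet) {s : State} (hs : Searching k K G F s)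
    (h7 : s.reg 7 ≠ 0) : Runs visit s (visitWeight n K) (fun s' =>
      (Searching k K G F s' ∧ s'.reg 5 = s.reg 5 + 1) ∨ Found k K G F s') := by
  have hht : s.reg 5 < s.reg 6 := by have := hs.length; omega
  set h := s.reg 5 with hh
  set t := s.reg 6 with ht
  set A := colors (s.arr 3) n K (h * (n * K)) with hA
  have hAp : Proper G A := hs.proper h le_rfl hht
  refine Runs.imp (Q := fun s' => (∀ r, 25 ≤ r → s'.reg r = s.reg r) →
      (Searching k K G F s' ∧ s'.reg 5 = h + 1) ∨ Found k K G F s')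
    (T := visitWeight n K) ?_ le_rfl
    fun s' ha hq => hq fun r hr => ha.1 r (keepsReg_visit hr)
  refine Runs.imp (T := (1 + n * K) + ((n * (n * (n + K * (2 * K + 20) + 20) + 6) + 4) +
      ((1 + (K * (n * (K + 2 * n + 23) + 8 * (n * K) + 2 * K + 21) + 3 + 2)) + 16)))
    (Q := fun s' => (∀ r, 25 ≤ r → s'.reg r = s.reg r) →
      (Searching k K G F s' ∧ s'.reg 5 = h + 1) ∨ Found k K G F s') ?_
    (by simp only [visitWeight]; omega) fun _ _ h => h
  refine Runs.seq (Q := fun s' => s' = s.setReg 9 (h * (n * K)))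
    (.straight rfl (by simp [weight, hs.reg_three]) (by simp [eval, hs.reg_three, hh])) ?_
  rintro _ - rfl
  set s₁ := s.setReg 9 (h * (n * K)) with hs₁
  have c0 : s₁.reg 0 = n := hs.reg_zero
  have c2 : s₁.reg 2 = K := hs.reg_two
  have c9 : s₁.reg 9 = h * (n * K) := by simp [hs₁, State.reg_setReg]
  refine Runs.seq (Runs.imp (findDemand_runs s₁ hs.reg_four ?_) (by rw [c0, c2])
    fun _ _ h => h) ?_
  · exact hs.reg_eq_zero 25 (by norm_num)
  intro s₂ ha₂ hfind
  rw [c0, c2, c9] at hfind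
  -- The effect of `clear` is anticipated: the branches prove the claim for any state with their
  -- arrays and low registers and with zeros from register `9` on.
  refine Runs.seq (Q := fun s' => (∀ r, 25 ≤ r → s'.reg r = s.reg r) →
      (∀ s'', s''.arr = s'.arr → (∀ r < 9, s''.reg r = s'.reg r) →
        (∀ r, 9 ≤ r → s''.reg r = 0) →
      (Searching k K G F s'' ∧ s''.reg 5 = h + 1) ∨ Found k K G F s'')) ?_ ?_
  swap
  · intro s₃ ha₃ hq
    refine Runs.imp (clear_runs s₃) le_rfl ?_
    rintro s₄ ha₄ ⟨q1, q2, q3⟩ h25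
    have k25 : ∀ r, 25 ≤ r → s₃.reg r = s.reg r := fun r hr => by
      rw [← h25 r hr, ha₄.1 r]
      have : ∀ i < 25, r ≠ i := by omega
      simp [clear, keepsReg, this]
    exact hq k25 s₄ q1 q2 fun r hr => q3 r hr fun hr' => by
      rw [k25 r hr']; exact hs.reg_eq_zero r hr
  have d0 : s₂.reg 0 = n := (ha₂.1 0 rfl).trans hs.reg_zero
  have d1 : s₂.reg 1 = k := (ha₂.1 1 rfl).trans hs.reg_one
  have d2 : s₂.reg 2 = K := (ha₂.1 2 rfl).trans hs.reg_two
  have d3 : s₂.reg 3 = n * K := (ha₂.1 3 rfl).trans hs.reg_three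
  have d4 : s₂.reg 4 = 1 := (ha₂.1 4 rfl).trans hs.reg_four
  have d5 : s₂.reg 5 = h := (ha₂.1 5 rfl)
  have d6 : s₂.reg 6 = t := (ha₂.1 6 rfl)
  have d8 : s₂.reg 8 = 0 := (ha₂.1 8 rfl).trans hs.success
  have d9 : s₂.reg 9 = h * (n * K) := (ha₂.1 9 rfl).trans c9
  have darr : s₂.arr = s.arr := by
    funext a
    exact ha₂.2 a (by simp [findDemand, shareTest, forLoop, keepsArr])
  refine Runs.ite (fun h13 => ?_) (fun h13 => ?_)
  · obtain ⟨hx, hy, hxy, hns⟩ := hfind.2 h13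
    obtain ⟨x, ex⟩ : ∃ x : Fin n, x.1 = s₂.reg 11 := ⟨⟨_, hx⟩, rfl⟩
    obtain ⟨y, ey⟩ : ∃ y : Fin n, y.1 = s₂.reg 12 := ⟨⟨_, hy⟩, rfl⟩
    rw [← ex, ← ey] at hxy hns
    have hdem : x = y ∨ s(x, y) ∈ F := (hs.demand x y).1 hxy
    have hnadj : ¬ G.Adj x y := by
      rcases hdem with rfl | hdem
      · exact G.irrefl
      · exact ((SimpleGraph.compl_adj _ _ _).1 (hF hdem)).2
    have hns' : ¬ ∃ c, c ∈ A x ∧ c ∈ A y := fun hc => hns (shares_iff.2 hc)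
    refine Runs.seq (expand_runs (G := G) (h := h) (t := t) (x := x) (y := y) s₂ d4 d0 d2 d3 d6 d9
      hht ex.symm ey.symm (by rw [darr]; exact hs.adj) (by rw [darr]; exact hs.arr_le 3)) ?_
    rw [darr, ← hA]
    rintro s₃ ha₃ ⟨j1, j2, j3, j4, j5, j6⟩
    refine .straight rfl (by simp [weight]) ?_
    intro h25 s₄ q1 q2 q3
    left
    simp only [eval, State.arr_setReg] at q1 q2
    have e0 : s₄.reg 0 = n := by
      rw [q2 0 (by norm_num)]; simpa [State.reg_setReg] using (ha₃.1 0 rfl).trans d0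
    have e1 : s₄.reg 1 = k := by
      rw [q2 1 (by norm_num)]; simpa [State.reg_setReg] using (ha₃.1 1 rfl).trans d1
    have e2 : s₄.reg 2 = K := by
      rw [q2 2 (by norm_num)]; simpa [State.reg_setReg] using (ha₃.1 2 rfl).trans d2
    have e3 : s₄.reg 3 = n * K := by
      rw [q2 3 (by norm_num)]; simpa [State.reg_setReg] using (ha₃.1 3 rfl).trans d3
    have e4 : s₄.reg 4 = 1 := by
      rw [q2 4 (by norm_num)]; simpa [State.reg_setReg] using (ha₃.1 4 rfl).trans d4
    have f5 : s₃.reg 5 = h := (ha₃.1 5 rfl).trans d5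
    have f4 : s₃.reg 4 = 1 := (ha₃.1 4 rfl).trans d4
    have e5 : s₄.reg 5 = h + 1 := by
      rw [q2 5 (by norm_num)]; simp [State.reg_setReg, f4, f5]
    have e6 : s₄.reg 6 = s₃.reg 6 := by
      rw [q2 6 (by norm_num)]; simp [State.reg_setReg]
    have e7 : s₄.reg 7 = s₃.reg 6 - (h + 1) := by
      rw [q2 7 (by norm_num)]; simp [State.reg_setReg, f4, f5]
    have e8 : s₄.reg 8 = 0 := by
      rw [q2 8 (by norm_num)]; simpa [State.reg_setReg] using (ha₃.1 8 rfl).trans d8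
    have ga : ∀ a, a ≠ 3 → s₄.arr a = s.arr a := by
      intro a ha
      rw [q1, ha₃.2 a (by simp [expand, conflictTest, push, forLoop, keepsArr, ha]), darr]
    have hold : ∀ i < t, colors (s₃.arr 3) n K (i * (n * K)) =
        colors (s.arr 3) n K (i * (n * K)) := fun i hi => colors_congr hi j3
    have hprop : ∀ i, h + 1 ≤ i → i < s₃.reg 6 →
        Proper G (colors (s₃.arr 3) n K (i * (n * K))) := by
      intro i hi hi'
      by_cases hit : i < t
      · rw [hold i hit]; exact hs.proper i (by omega) hit
      · obtain ⟨c, hc, hc'⟩ := j5 i (by omega) hi'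
        rw [hc']
        exact hAp.extend hnadj hc
    have hpot : h + 1 + ∑ i ∈ Finset.Ico (h + 1) (s₃.reg 6),
        treeSize K (G.indepNum * K - total (colors (s₃.arr 3) n K (i * (n * K)))) ≤
          visits K G := by
      have h1 := hs.potential
      -- Split off the head's share of the potential; it pays for the step of the head pointer and
      -- for the children.
      rw [← hh, ← ht, Finset.sum_eq_sum_Ico_succ_bot hht, ← hA] at h1
      rw [← Finset.sum_Ico_consecutive _ hht j1]
      have h2 := one_add_sum_le (L := G.indepNum * K) (p := total A)
        (q := fun i => total (colors (s₃.arr 3) n K (i * (n * K)))) j2 (fun i hi hi' => by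
          refine ⟨?_, (hprop i (by omega) hi').total_le⟩
          obtain ⟨c, hc, hc'⟩ := j5 i hi hi'
          rw [hc']
          exact total_lt_total_extend hns')
      have h3 : ∑ i ∈ Finset.Ico (h + 1) t,
          treeSize K (G.indepNum * K - total (colors (s₃.arr 3) n K (i * (n * K)))) =
          ∑ i ∈ Finset.Ico (h + 1) t,
          treeSize K (G.indepNum * K - total (colors (s.arr 3) n K (i * (n * K)))) :=
        Finset.sum_congr rfl fun i hi => by rw [hold i (Finset.mem_Ico.1 hi).2]
      rw [h3]
      omega
    -- Every queue entry contributes at least `1` to the potential, so the tail pointer too is at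
    -- most `visits`.
    have hcard : s₃.reg 6 - (h + 1) ≤ ∑ i ∈ Finset.Ico (h + 1) (s₃.reg 6),
        treeSize K (G.indepNum * K - total (colors (s₃.arr 3) n K (i * (n * K)))) := by
      have := Finset.card_nsmul_le_sum (Finset.Ico (h + 1) (s₃.reg 6)) (fun i =>
        treeSize K (G.indepNum * K - total (colors (s₃.arr 3) n K (i * (n * K))))) 1
        (fun i _ => treeSize_pos _ _)
      simpa using this
    refine ⟨⟨⟨e0, e1, e2, e3, e4, ?_, ?_, ?_, by omega, q3, ?_, ?_, ?_, ?_⟩, ?_, ?_, e8, ?_, ?_,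
      ?_⟩, e5⟩
    · omega
    · omega
    · omega
    · rw [ga 0 (by norm_num)]; exact hs.adj
    · rw [ga 1 (by norm_num)]; exact hs.demand
    · rw [ga 2 (by norm_num)]; exact hs.out
    · intro a
      by_cases ha : a = 3
      · subst ha; rw [q1]; exact j4
      · rw [ga a ha]; exact hs.arr_le a
    · rw [e7, e6, e5]
    · omega
    · rw [e5, e6, q1]; exact hprop
    · rw [e5, e6, q1]; exact hpot
    · rw [e5, e6, q1]
      intro B hB
      obtain ⟨i, i1, i2, i3⟩ := hs.complete B hB
      -- If the entry below `B` is the removed head, one of its children takes over; otherwise it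
      -- stays in the queue.
      rcases eq_or_lt_of_le i1 with hi | hi
      · rw [← hi] at i3
        obtain ⟨c, hc, hc'⟩ := exists_extend_le hB i3 hdem
        obtain ⟨l, l1, l2, l3⟩ := j6 c hc
        exact ⟨l, by omega, l2, by rw [l3]; exact hc'⟩
      · exact ⟨i, by omega, by omega, by rw [hold i i2]; exact i3⟩
  · refine .straight rfl (by simp [weight]) ?_
    intro h25 s₄ q1 q2 q3
    right
    simp only [eval, State.arr_setReg] at q1 q2
    rw [darr] at q1
    have e : ∀ r < 7, s₄.reg r = s.reg r := fun r hr => by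
      rw [q2 r (by omega)]
      interval_cases r <;> simp [State.reg_setReg] <;> exact ha₂.1 _ rfl
    have e7 : s₄.reg 7 = 0 := by rw [q2 7 (by norm_num)]; simp [State.reg_setReg]
    have e8 : s₄.reg 8 = 1 := by rw [q2 8 (by norm_num)]; simp [State.reg_setReg]
    have hmet := hfind.1 h13
    refine ⟨⟨?_, ?_, ?_, ?_, ?_, ?_, ?_, by omega, by omega, q3, ?_, ?_, ?_, ?_⟩, e7, e8, ?_⟩
    · rw [e 0 (by norm_num)]; exact hs.reg_zero
    · rw [e 1 (by norm_num)]; exact hs.reg_one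
    · rw [e 2 (by norm_num)]; exact hs.reg_two
    · rw [e 3 (by norm_num)]; exact hs.reg_three
    · rw [e 4 (by norm_num)]; exact hs.reg_four
    · rw [e 5 (by norm_num)]; exact hs.head_le
    · rw [e 6 (by norm_num)]; exact hs.tail_le
    · rw [q1]; exact hs.adj
    · rw [q1]; exact hs.demand
    · rw [q1]; exact hs.out
    · rw [q1]; exact hs.arr_le
    · rw [q1, e 5 (by norm_num), ← hh, ← hA]
      refine ⟨fun v => ?_, hAp, fun u v huv => ?_⟩
      · obtain ⟨c, hc, -⟩ := shares_iff.1 (hmet v v.2 v v.2 ((hs.demand v v).2 (.inl rfl)))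
        exact ⟨c, hc⟩
      · exact shares_iff.1 (hmet u u.2 v v.2 ((hs.demand u v).2 (.inr huv)))

/-- Induction on the number `j` of visits that the potential still allows. Each visit is charged
from `width` afresh, so the time is linear in `j`. The term `2 + 2 * width k K G` covers the loop
test before a visit and the one after a success. -/
theorem search_exec (hF : F ⊆ Gᶜ.edgeSet) : ∀ (j : ℕ) (s : State), Searching k K G F s →
    visits K G ≤ s.reg 5 + j → ∃ s' t, Exec (.loop 7 visit) s s' t ∧
      (Found k K G F s' ∨ (Layout k K G F s' ∧ s'.reg 8 = 0 ∧
        ¬ ∃ B : Fin n → Finset (Fin K), IsColoring G F B)) ∧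
      t ≤ (j + 1) * (2 + 2 * width k K G +
        visitWeight n K * (3 + 2 * (width k K G + visitWeight n K))) := by
  intro j
  induction j with
  | zero =>
    intro s hs hj
    have hb := hs.bdd.1 7
    -- The head pointer has used up the whole potential, whereas a queue entry would need at least
    -- `1` more.
    have h7 : s.reg 7 = 0 := by
      by_contra h7
      have hht : s.reg 5 < s.reg 6 := by have := hs.length; omega
      have h1 := hs.potential
      rw [Finset.sum_eq_sum_Ico_succ_bot hht] at h1
      have := treeSize_pos K (G.indepNum * K - total (colors (s.arr 3) n K (s.reg 5 * (n * K))))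
      omega
    refine ⟨s, _, .loop_eq h7, .inr ⟨hs.toLayout, hs.success, ?_⟩, by omega⟩
    rintro ⟨B, hB⟩
    obtain ⟨i, h1, h2, -⟩ := hs.complete B hB
    have := hs.length
    omega
  | succ j ih =>
    intro s hs hj
    have hb := hs.bdd.1 7
    by_cases h7 : s.reg 7 = 0
    · refine ⟨s, _, .loop_eq h7, .inr ⟨hs.toLayout, hs.success, ?_⟩,
        by rw [Nat.succ_mul]; omega⟩
      rintro ⟨B, hB⟩
      obtain ⟨i, h1, h2, -⟩ := hs.complete B hB
      have := hs.length
      omega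
    · obtain ⟨s₁, t₁, he, hq, hw⟩ := visit_runs hF hs h7
      have ht := (hw _ hs.bdd).1
      rcases hq with ⟨hq, h5⟩ | hq
      · obtain ⟨s₂, t₂, he₂, hq₂, ht₂⟩ := ih s₁ hq (by omega)
        refine ⟨s₂, _, .loop_ne h7 he he₂, hq₂, ?_⟩
        rw [Nat.succ_mul]
        omega
      · refine ⟨s₁, _, .loop_ne h7 he (.loop_eq hq.length), .inl hq, ?_⟩
        have hb₁ := hq.bdd.1 7
        rw [Nat.succ_mul]
        nlinarith

end

end PMC

/-! ### Initialization and output. -/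

namespace PMC

open RAM RAM.Program

/-- Compute the number `min k (n * n)` of colors in use, add the diagonal to the demands, and put
the empty assignment into the queue. -/
def setup : Program :=
  .const 4 1 ;; .mul 2 0 0 ;; .sub 2 1 2 ;; .sub 2 1 2 ;; .mul 3 2 0 ;; .const 6 1 ;; .const 7 1 ;;
  forLoop 14 15 0 (.mul 20 14 0 ;; .add 20 20 14 ;; .store 1 20 4) ;; clear

/-- Write the answer. -/
def answer : Program :=
  .ite 8
    (.mul 9 5 3 ;; forLoop 14 15 0 (forLoop 18 19 2
      (.mul 20 14 2 ;; .add 20 20 18 ;; .add 20 20 9 ;; .load 21 3 20 ;;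
        .mul 20 1 14 ;; .add 20 20 18 ;; .store 2 20 21)) ;; .const 0 1)
    (.const 0 0)

/-- The program that solves Pairwise Mutual Colorability. -/
def solve : Program :=
  .ite 0 (setup ;; .loop 7 visit ;; answer) (.const 0 1)

theorem keepsReg_setup {r : ℕ} (h : 25 ≤ r) : setup.keepsReg r = true := by
  have : ∀ i < 25, r ≠ i := by omega
  simp [setup, clear, forLoop, keepsReg, this]

section

variable {n : ℕ} {k : ℕ} {G : SimpleGraph (Fin n)} {F : Set (Sym2 (Fin n))}

theorem input_arr_zero (i j : Fin n) : (input G k F).arr 0 (i * n + j) ≠ 0 ↔ G.Adj i j := by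
  simp only [input, if_true, ne_eq, ite_eq_right_iff, one_ne_zero, imp_false, not_not]
  constructor
  · rintro ⟨i', j', h, h'⟩
    obtain ⟨h1, h2⟩ := (mul_add_inj j.2 j'.2).1 h
    rwa [Fin.ext h1, Fin.ext h2]
  · exact fun h => ⟨i, j, rfl, h⟩

theorem input_arr_one (i j : Fin n) : (input G k F).arr 1 (i * n + j) ≠ 0 ↔ s(i, j) ∈ F := by
  simp only [input, one_ne_zero, if_false, if_true, ne_eq, ite_eq_right_iff, imp_false, not_not]
  constructor
  · rintro ⟨i', j', h, h'⟩
    obtain ⟨h1, h2⟩ := (mul_add_inj j.2 j'.2).1 h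
    rwa [Fin.ext h1, Fin.ext h2]
  · exact fun h => ⟨i, j, rfl, h⟩

theorem input_arr_le (a x : ℕ) : (input G k F).arr a x ≤ 1 := by
  simp only [input]
  split_ifs <;> simp

theorem setup_runs : Runs setup (input G k F) (n * (n + 10) + 2 * n + 40)
    (fun s => Searching k (min k (n * n)) G F s ∧ s.reg 5 = 0) := by
  set s₀ := input G k F with hs₀
  set K := min k (n * n) with hK
  -- Truncated subtraction computes the minimum.
  have hsub : k - (k - n * n) = K := by omega
  refine Runs.imp (Q := fun s => (∀ r, 25 ≤ r → s.reg r = 0) →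
      Searching k K G F s ∧ s.reg 5 = 0)
    (T := 2 + ((1 + n) + (1 + (1 + ((1 + n) + (2 + (2 + ((n * (n + 3 + 3) + 3) + 16))))))))
    ?_ (by ring_nf; omega) ?_
  swap
  · intro s' ha hq
    refine hq fun r hr => ?_
    rw [ha.1 r (keepsReg_setup hr)]
    have h0 : r ≠ 0 := by omega
    have h1 : r ≠ 1 := by omega
    simp [hs₀, input, h0, h1]
  refine Runs.seq (Q := fun s => s = s₀.setReg 4 1) (.straight rfl (by simp [weight]) rfl) ?_
  rintro _ - rfl
  set s₁ := s₀.setReg 4 1 with hs₁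
  have a0 : s₁.reg 0 = n := rfl
  have a1 : s₁.reg 1 = k := rfl
  refine Runs.seq (Q := fun s => s = s₁.setReg 2 (n * n))
    (.straight rfl (by simp [weight, a0]) (by simp [eval, a0])) ?_
  rintro _ - rfl
  refine Runs.seq (Q := fun s => s = (s₁.setReg 2 (n * n)).setReg 2 (k - n * n))
    (.straight rfl (by simp [weight]) (by simp [eval, a1, State.reg_setReg])) ?_
  rintro _ - rfl
  set s₂ := (s₁.setReg 2 (n * n)).setReg 2 (k - n * n) with hs₂
  have b0 : s₂.reg 0 = n := rfl
  refine Runs.seq (Q := fun s => s = s₂.setReg 2 K)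
    (.straight rfl (by simp [weight]) (by simp [eval, hs₂, a1, State.reg_setReg, hsub])) ?_
  rintro _ - rfl
  refine Runs.seq (Q := fun s => s = (s₂.setReg 2 K).setReg 3 (n * K))
    (.straight rfl (by simp [weight, b0, State.reg_setReg])
      (by simp [eval, b0, State.reg_setReg, mul_comm])) ?_
  rintro _ - rfl
  refine Runs.seq (Q := fun s => s = ((s₂.setReg 2 K).setReg 3 (n * K)).setReg 6 1)
    (.straight rfl (by simp [weight]) rfl) ?_
  rintro _ - rfl
  refine Runs.seq (Q := fun s => s = (((s₂.setReg 2 K).setReg 3 (n * K)).setReg 6 1).setReg 7 1)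
    (.straight rfl (by simp [weight]) rfl) ?_
  rintro _ - rfl
  set s₃ := (((s₂.setReg 2 K).setReg 3 (n * K)).setReg 6 1).setReg 7 1 with hs₃
  have c0 : s₃.reg 0 = n := rfl
  have c4 : s₃.reg 4 = 1 := rfl
  have carr : s₃.arr = s₀.arr := rfl
  refine Runs.seq (Q := fun s => (∀ a, s.arr 1 a ≤ 1) ∧ ∀ i j : Fin n, s.arr 1 (i * n + j) ≠ 0 ↔
      (i = j ∧ i.1 < n) ∨ s(i, j) ∈ F) (Runs.forLoop (s₀ := s₃) (T := n + 3)
    (fun l s => (∀ a, s.arr 1 a ≤ 1) ∧ ∀ i j : Fin n, s.arr 1 (i * n + j) ≠ 0 ↔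
      (i = j ∧ i.1 < l) ∨ s(i, j) ∈ F) rfl rfl rfl ?_ ?_ ?_) ?_
  · refine ⟨by rw [carr]; exact input_arr_le 1, fun i j => ?_⟩
    rw [carr, hs₀, input_arr_one]
    simp
  · intro m s x y h
    simpa [State.arr_setReg] using h
  · rintro l s hl ha hi ⟨h1, h2⟩
    have e0 : s.reg 0 = n := (ha.1 0 rfl).trans c0
    have e4 : s.reg 4 = 1 := (ha.1 4 rfl).trans c4
    have hl' : l < n := hl
    refine .straight rfl (by simp [weight, e0]; omega) ⟨fun a => ?_, fun i j => ?_⟩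
    · simp only [eval, State.reg_setReg, State.arr_setReg, State.arr_setArr, e0, e4, hi]
      norm_num
      split_ifs
      exacts [by simp, h1 a]
    · simp only [eval, State.reg_setReg, State.arr_setReg, State.arr_setArr, e0, e4, hi]
      norm_num
      simp only [mul_add_inj j.2 hl']
      have h3 := h2 i j
      have h4 : (i = j ∧ i.1 ≤ l) ↔ (i.1 = l ∧ j.1 = l) ∨ (i = j ∧ i.1 < l) := by
        rw [Fin.ext_iff]; omega
      rw [h4]
      split_ifs with h5
      · simp [h5]
      · simp only [h5, false_or]; exact h3
  · rintro s₄ ha₄ ⟨h1, h2⟩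
    refine Runs.imp (clear_runs s₄) le_rfl ?_
    rintro s₅ ha₅ ⟨q1, q2, q3⟩ h25
    have k25 : ∀ r, 25 ≤ r → s₄.reg r = 0 := fun r hr => by
      rw [← h25 r hr, ha₅.1 r]
      have : ∀ i < 25, r ≠ i := by omega
      simp [clear, keepsReg, this]
    have e : ∀ r < 9, s₅.reg r = s₃.reg r := fun r hr => by
      rw [q2 r hr]
      interval_cases r <;> exact ha₄.1 _ rfl
    have ga : ∀ a, a ≠ 1 → s₅.arr a = s₀.arr a := fun a ha => by
      rw [q1, ha₄.2 a (by simp [forLoop, keepsArr, ha]), carr]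
    have e5 : s₅.reg 5 = 0 := e 5 (by norm_num)
    have e6 : s₅.reg 6 = 1 := e 6 (by norm_num)
    have e7 : s₅.reg 7 = 1 := e 7 (by norm_num)
    have e8 : s₅.reg 8 = 0 := e 8 (by norm_num)
    have hv : 1 ≤ visits K G := treeSize_pos _ _
    have hcol : ∀ v, colors (s₅.arr 3) n K (0 * (n * K)) v = ∅ := fun v => by
      rw [ga 3 (by norm_num)]
      ext c
      rw [mem_colors]
      simp [hs₀, input]
    refine ⟨⟨⟨e 0 (by norm_num), e 1 (by norm_num), e 2 (by norm_num), e 3 (by norm_num),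
      e 4 (by norm_num), by omega, by omega, by omega, by omega,
      fun r hr => q3 r hr (k25 r), ?_, ?_, ?_, ?_⟩, by omega, by omega, e8, ?_, ?_, ?_⟩, e5⟩
    · rw [ga 0 (by norm_num)]; exact input_arr_zero
    · intro i j
      rw [q1, h2 i j]
      simp
    · rw [ga 2 (by norm_num)]
      intro a
      simp [hs₀, input]
    · intro a
      by_cases ha : a = 1
      · subst ha; rw [q1]; exact h1
      · rw [ga a ha]; exact input_arr_le a
    · intro i _ hi u v _
      obtain rfl : i = 0 := by omega
      rw [hcol]
      simp
    · rw [e5, e6]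
      have : total (colors (s₅.arr 3) n K (0 * (n * K))) = 0 := by
        simp only [total, hcol, Finset.card_empty, Finset.sum_const_zero]
      -- The only entry is the root, with no incidences, and its tree size is exactly `visits`.
      rw [Finset.sum_Ico_succ_top le_rfl, Finset.Ico_self, Finset.sum_empty, this]
      simp [visits]
    · intro B hB
      refine ⟨0, by omega, by omega, fun v => ?_⟩
      rw [hcol]
      simp

theorem mem_output {s : State} {v : Fin n} {c : Fin k} :
    c ∈ output n k s v ↔ s.arr 2 (v * k + c) ≠ 0 := by
  simp [output]

theorem isColoring_of_le {K : ℕ} (hK : K ≤ k) {A : Fin n → Finset (Fin k)}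
    {B : Fin n → Finset (Fin K)} (hB : IsColoring G F B)
    (hAB : ∀ v (c : Fin k), c ∈ A v ↔ ∃ h : c.1 < K, (⟨c, h⟩ : Fin K) ∈ B v) :
    IsColoring G F A := by
  have up : ∀ {v} {c : Fin K}, c ∈ B v → (⟨c, c.2.trans_le hK⟩ : Fin k) ∈ A v :=
    fun {v c} hc => (hAB _ _).2 ⟨c.2, hc⟩
  refine ⟨fun v => ?_, fun u v huv => ?_, fun u v huv => ?_⟩
  · obtain ⟨c, hc⟩ := hB.nonempty v
    exact ⟨_, up hc⟩
  · rw [Finset.disjoint_left]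
    intro c hu hv
    obtain ⟨h, hu⟩ := (hAB _ _).1 hu
    obtain ⟨_, hv⟩ := (hAB _ _).1 hv
    exact Finset.disjoint_left.1 (hB.disjoint u v huv) hu hv
  · obtain ⟨c, hu, hv⟩ := hB.shared u v huv
    exact ⟨_, up hu, up hv⟩

/-- Output rows have length `k`, but only their first `K` columns are written; the rest of array `2`
is still zero. So the weight does not depend on `k` beyond `K`. -/
theorem answer_runs (hF : F ⊆ Gᶜ.edgeSet) {s : State}
    (hs : Found k (min k (n * n)) G F s ∨ (Layout k (min k (n * n)) G F s ∧ s.reg 8 = 0 ∧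
      ¬ ∃ B : Fin n → Finset (Fin (min k (n * n))), IsColoring G F B)) :
    Runs answer s (n * (min k (n * n) * (min k (n * n) + n + 10) + 6) + n * min k (n * n) + 10)
      (fun s' => IsAnswer G k F s') := by
  set K := min k (n * n) with hK
  have hKk : K ≤ k := by omega
  rcases hs with hs | ⟨hs, h8, hno⟩
  · have e0 := hs.reg_zero
    have e2 := hs.reg_two
    have hb : ∀ P, Runs P s (1 + n * K + (n * (K * (K + n + 7 + 3) + 3 + 3) + 3 + 2))
        (fun s' => IsAnswer G k F s') → Runs (.ite 8 P (.const 0 0)) s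
        (n * (K * (K + n + 10) + 6) + n * K + 10) (fun s' => IsAnswer G k F s') := by
      intro P hP
      exact Runs.imp (Runs.ite (fun _ => hP) (fun h => absurd h (by rw [hs.success]; simp)))
        (by ring_nf; omega) fun _ _ h => h
    refine hb _ ?_
    set b := s.reg 5 * (n * K) with hbdef
    refine Runs.seq (Q := fun s' => s' = s.setReg 9 b)
      (.straight rfl (by simp [weight, hs.reg_three]) (by simp [eval, hs.reg_three, hbdef])) ?_
    rintro _ - rfl
    refine Runs.seq (Q := fun s' => ∀ v < n, ∀ c < k, s'.arr 2 (v * k + c) ≠ 0 ↔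
        c < K ∧ v < n ∧ s.arr 3 (v * K + c + b) ≠ 0) (T' := 2)
      (Runs.imp (Runs.forLoop (s₀ := s.setReg 9 b) (T := K * (K + n + 7 + 3) + 3)
      (fun m s' => ∀ v < n, ∀ c < k, s'.arr 2 (v * k + c) ≠ 0 ↔
        c < K ∧ v < m ∧ s.arr 3 (v * K + c + b) ≠ 0) rfl rfl hs.reg_four ?_ ?_ ?_)
        (by simp only [State.reg_setReg]; norm_num [e0]) (fun _ _ h => e0 ▸ h)) ?_
    · intro v _ c _
      simp [State.arr_setReg, hs.out]
    · intro m s' x y h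
      simpa [State.arr_setReg] using h
    · intro m s₁ hm ha hi hI
      have hm : m < n := e0 ▸ hm
      have f2 : s₁.reg 2 = K := (ha.1 2 rfl).trans e2
      refine Runs.imp (Runs.forLoop (s₀ := s₁) (T := K + n + 7)
        (fun l s' => ∀ v < n, ∀ c < k, s'.arr 2 (v * k + c) ≠ 0 ↔
          c < K ∧ (v < m ∨ v = m ∧ c < l) ∧ s.arr 3 (v * K + c + b) ≠ 0)
        rfl rfl ((ha.1 4 rfl).trans hs.reg_four) ?_ ?_ ?_) (by rw [f2]) ?_
      · simpa using hI
      · intro m s' x y h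
        simpa [State.arr_setReg] using h
      · intro l s₂ hl ha₂ hj hJ
        rw [f2] at hl
        have g1 : s₂.reg 1 = k := (ha₂.1 1 rfl).trans ((ha.1 1 rfl).trans hs.reg_one)
        have g2 : s₂.reg 2 = K := (ha₂.1 2 rfl).trans f2
        have g9 : s₂.reg 9 = b := (ha₂.1 9 rfl).trans (ha.1 9 rfl)
        have g14 : s₂.reg 14 = m := (ha₂.1 14 rfl).trans hi
        have g3 : s₂.arr 3 = s.arr 3 := (ha₂.2 3 rfl).trans (ha.2 3 rfl)
        refine .straight rfl ?_ fun v hv c hc => ?_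
        · simp [weight, eval, State.reg_setReg, g2, g14]; omega
        · simp only [eval, State.reg_setReg, State.arr_setReg, State.arr_setArr, g1, g2, g9, g14,
            g3, hj]
          norm_num
          simp only [mul_comm k m, mul_add_inj hc (hl.trans_le hKk)]
          split_ifs with h5
          · obtain ⟨rfl, rfl⟩ := h5
            simp [hl]
          · rw [← ne_eq, hJ v hv c hc]
            have : (v < m ∨ v = m ∧ c < l) ↔ (v < m ∨ v = m ∧ c ≤ l) := by omega
            rw [this]
      · intro s' _ h v hv c hc
        rw [h v hv c hc, f2]
        have : c < K ∧ (v < m ∨ v = m ∧ c < K) ↔ c < K ∧ v < m + 1 := by omega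
        rw [← and_assoc, this, and_assoc]
    · intro s₁ ha hq
      refine .straight rfl (by simp [weight]) (.inl ⟨by simp [eval, State.reg_setReg], ?_⟩)
      refine isColoring_of_le hKk hs.solution fun v c => ?_
      rw [mem_output, show (Program.eval (.const 0 1) s₁).arr = s₁.arr from rfl, hq v v.2 c c.2]
      simp only [mem_colors, v.2, true_and, exists_prop, hbdef]
  · refine Runs.imp (T := 1 + 1) (Runs.ite (fun h => absurd h8 h) fun _ =>
      .straight rfl (by simp [weight]) ?_) (by omega) fun _ _ h => h
    refine .inr ⟨by simp [eval, State.reg_setReg], ?_⟩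
    -- A failed search with `n * n` colors is impossible, so a negative answer occurs only when all
    -- `k` colors were in use.
    by_cases hk : n * n ≤ k
    · exact absurd (exists_isColoring_of_sq_le hF (by omega)) hno
    · have : K = k := by omega
      rwa [this] at hno

/-! ### Arithmetic of the running time. -/

theorem input_bdd : (input G k F).Bdd (n.size + k.size + 1) := by
  refine ⟨fun r => ?_, fun a x => ?_⟩
  · simp only [input]
    split_ifs
    · omega
    · omega
    · simp
  · have := Nat.size_le_size (input_arr_le (G := G) (k := k) (F := F) a x)
    rw [Nat.size_one] at this
    omega

/-- Every quantity in the running time is polynomial, except `visits K G` and the bit length of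
`k`. -/
theorem visits_mul_size_le (hn : n ≠ 0) :
    visits (min k (n * n)) G * (k.size + 1) ≤ 3 * k ^ (G.indepNum * k) * (n + 1) ^ 5 := by
  set K := min k (n * n) with hK
  set α := G.indepNum with hα
  -- This makes `α * k` strictly larger than `α * K` as soon as `K < k`.
  have hα1 : 1 ≤ α := by
    have : G.IsIndepSet (({⟨0, Nat.pos_of_ne_zero hn⟩} : Finset (Fin n)) : Set (Fin n)) := by simp
    simpa using this.card_le_indepNum
  have hαn : α ≤ n := by
    obtain ⟨s, hs⟩ := G.exists_isNIndepSet_indepNum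
    have := s.card_le_univ
    rw [hs.card_eq] at this
    simpa using this
  have hKn : K ≤ n * n := min_le_right _ _
  have hL : α * K + 1 ≤ (n + 1) ^ 3 := by
    have := Nat.mul_le_mul hαn hKn
    nlinarith
  have hsize := size_le_self k
  have main : (max K 1) ^ (α * K) * (k.size + 1) ≤ 3 * k ^ (α * k) * (n + 1) ^ 2 := by
    rcases le_or_gt k (n * n) with h | h
    · have hKk : K = k := by omega
      have h1 : k.size + 1 ≤ (n + 1) ^ 2 := by nlinarith
      have h2 : (max K 1) ^ (α * K) ≤ k ^ (α * k) := by
        rw [hKk]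
        rcases Nat.eq_zero_or_pos k with rfl | hk
        · simp
        · rw [max_eq_left hk]
      calc _ ≤ k ^ (α * k) * (n + 1) ^ 2 := Nat.mul_le_mul h2 h1
        _ ≤ _ := by nlinarith [Nat.zero_le (k ^ (α * k) * (n + 1) ^ 2)]
    · have hKk : K = n * n := by omega
      have h1 : k.size + 1 ≤ 2 * k := by omega
      have hk : 1 ≤ k := by omega
      have hm : max K 1 ≤ k := by omega
      -- The spare factor `k` that pays for the bit length of `k`.
      have h2 : α * K + 1 ≤ α * k := by
        have := Nat.mul_le_mul_left α (show K + 1 ≤ k by omega)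
        rw [mul_add] at this
        omega
      calc _ ≤ k ^ (α * K) * (2 * k) := Nat.mul_le_mul (Nat.pow_le_pow_left hm _) h1
        _ = 2 * k ^ (α * K + 1) := by ring
        _ ≤ 2 * k ^ (α * k) := Nat.mul_le_mul_left _ (Nat.pow_le_pow_right hk h2)
        _ ≤ 3 * k ^ (α * k) * (n + 1) ^ 2 := by
          have : 1 ≤ (n + 1) ^ 2 := Nat.one_le_pow _ _ (by omega)
          nlinarith [Nat.zero_le (k ^ (α * k))]
  calc visits K G * (k.size + 1)
      ≤ ((α * K + 1) * (max K 1) ^ (α * K)) * (k.size + 1) :=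
        Nat.mul_le_mul_right _ (treeSize_le _ _)
    _ = (α * K + 1) * ((max K 1) ^ (α * K) * (k.size + 1)) := by ring
    _ ≤ (n + 1) ^ 3 * (3 * k ^ (α * k) * (n + 1) ^ 2) := Nat.mul_le_mul hL main
    _ = _ := by ring

/-- The number of visits is exponential, but its bit length is at most `K * (α * K) + 1 ≤ n ^ 5 +
1`. -/
theorem width_le : width k (min k (n * n)) G ≤ 8 * (n + 1) ^ 5 * (k.size + 1) := by
  set K := min k (n * n) with hK
  have hKn : K ≤ n * n := min_le_right _ _
  have hαn : G.indepNum ≤ n := by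
    obtain ⟨s, hs⟩ := G.exists_isNIndepSet_indepNum
    have := s.card_le_univ
    rw [hs.card_eq] at this
    simpa using this
  have h1 : (visits K G).size ≤ n ^ 5 + 1 := by
    have h2 : K * (G.indepNum * K) ≤ n ^ 5 := by
      calc K * (G.indepNum * K) ≤ n * n * (n * (n * n)) := by gcongr
        _ = n ^ 5 := by ring
    calc (visits K G).size ≤ (2 ^ (K * (G.indepNum * K))).size :=
          Nat.size_le_size (treeSize_le_two_pow _ _)
      _ = K * (G.indepNum * K) + 1 := Nat.size_pow
      _ ≤ n ^ 5 + 1 := by omega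
  have h2 : (n + K + n * K + 1 + visits K G).size ≤
      (n + K + n * K + 1) + (n ^ 5 + 1) + 1 := by
    have := size_add_le (n + K + n * K + 1) (visits K G)
    have := size_le_self (n + K + n * K + 1)
    omega
  have h3 : n * K ≤ n * (n * n) := by gcongr
  have h4 : width k K G ≤ n + n * n + n * (n * n) + n ^ 5 + 3 + k.size := by
    unfold width
    omega
  set X := n + 1 with hX
  have hX1 : 1 ≤ X := by omega
  have p1 : n ≤ X ^ 5 := (show n ≤ X by omega).trans (Nat.le_self_pow (by norm_num) X)
  have p2 : n * n ≤ X ^ 5 := by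
    calc n * n ≤ X * X := by gcongr <;> omega
      _ = X ^ 2 := by ring
      _ ≤ X ^ 5 := Nat.pow_le_pow_right hX1 (by norm_num)
  have p3 : n * (n * n) ≤ X ^ 5 := by
    calc n * (n * n) ≤ X * (X * X) := by gcongr <;> omega
      _ = X ^ 3 := by ring
      _ ≤ X ^ 5 := Nat.pow_le_pow_right hX1 (by norm_num)
  have p5 : n ^ 5 ≤ X ^ 5 := Nat.pow_le_pow_left (by omega) 5
  have p0 : 1 ≤ X ^ 5 := Nat.one_le_pow _ _ hX1
  nlinarith [Nat.zero_le (X ^ 5 * k.size), Nat.mul_le_mul_right k.size p0]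

end

end PMC

/-! ### Assembly of the bounds. -/

namespace PMC

open RAM RAM.Program

/-- Simplifies the time bound of `Runs`; here `419 = 3 + 2 * (8 + 200)` and `83800 = 200 * 419`. -/
theorem mul_cost_le {A B P κ : ℕ} (hA : A ≤ 200 * P) (hB : B ≤ 8 * P * κ) (hP : 1 ≤ P)
    (hκ : 1 ≤ κ) : A * (3 + 2 * (B + A)) ≤ 83800 * (P ^ 2 * κ) := by
  have h1 : P ≤ P * κ := Nat.le_mul_of_pos_right _ hκ
  have h2 : 3 + 2 * (B + A) ≤ 419 * (P * κ) := by
    have : 8 * P * κ = 8 * (P * κ) := by ring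
    omega
  calc A * (3 + 2 * (B + A)) ≤ 200 * P * (419 * (P * κ)) := Nat.mul_le_mul hA h2
    _ = 83800 * (P ^ 2 * κ) := by ring

theorem visitWeight_le {n K X : ℕ} (hn : n + 1 = X) (hK : K ≤ X ^ 2) :
    visitWeight n K ≤ 200 * X ^ 6 := by
  have hn' : n ≤ X := by omega
  have hX : 1 ≤ X := by omega
  have h : visitWeight n K ≤ 1 + X * X ^ 2 +
      (X * (X * (X + X ^ 2 * (2 * X ^ 2 + 20) + 20) + 6) + 4) +
      (X ^ 2 * (X * (X ^ 2 + 2 * X + 23) + 8 * (X * X ^ 2) + 2 * X ^ 2 + 21) + 10) + 16 := by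
    unfold visitWeight
    gcongr
  refine h.trans ?_
  have p : ∀ i ≤ 6, X ^ i ≤ X ^ 6 := fun i hi => Nat.pow_le_pow_right hX hi
  have p0 := p 0 (by norm_num)
  have p1 := p 1 (by norm_num)
  have p2 := p 2 (by norm_num)
  have p3 := p 3 (by norm_num)
  have p4 := p 4 (by norm_num)
  have p5 := p 5 (by norm_num)
  ring_nf at p0 p1 p2 p3 p4 p5 ⊢
  omega

/-- The exponent is `17 = 12 + 5`: twice the degree `6` of `visitWeight`, and `5` from
`visits_mul_size_le`. The case `n = 0` is decided at once, since with `α = 0` nothing would absorb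
the bit length of `k`. -/
theorem solve_correct {n k : ℕ} {G : SimpleGraph (Fin n)} {F : Set (Sym2 (Fin n))}
    (hF : F ⊆ Gᶜ.edgeSet) : ∃ s t, Exec solve (input G k F) s t ∧ IsAnswer G k F s ∧
      t ≤ 1100000 * k ^ (G.indepNum * k) * (n + 1) ^ 17 := by
  rcases Nat.eq_zero_or_pos n with rfl | hn
  · refine ⟨_, _, .ite_eq rfl (.const _ 0 1), .inl ⟨by simp [State.reg_setReg], ?_⟩, ?_⟩
    · exact ⟨fun v => v.elim0, fun v => v.elim0, fun v => v.elim0⟩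
    · have h1 : 1 ≤ k ^ (G.indepNum * k) := by
        rcases Nat.eq_zero_or_pos k with rfl | hk
        · simp
        · exact Nat.one_le_pow _ _ hk
      have h2 : 1 + ((input G k F).reg 0).size + (1 + Nat.size 1) = 3 := by simp [input]
      rw [h2]
      simp only [zero_add, one_pow, mul_one]
      omega
  · set K := min k (n * n) with hK
    set X := n + 1 with hX
    set κ := k.size + 1 with hκ
    have hX1 : 1 ≤ X := by omega
    have hn' : n ≤ X := by omega
    have hK2 : K ≤ X ^ 2 := by
      calc K ≤ n * n := min_le_right _ _
        _ ≤ X * X := Nat.mul_le_mul hn' hn'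
        _ = X ^ 2 := by ring
    have p : ∀ i ≤ 6, X ^ i ≤ X ^ 6 := fun i hi => Nat.pow_le_pow_right hX1 hi
    have p0 := p 0 (by norm_num)
    have p1 := p 1 (by norm_num)
    have p2 := p 2 (by norm_num)
    have p3 := p 3 (by norm_num)
    have p4 := p 4 (by norm_num)
    have p5 := p 5 (by norm_num)
    simp only [pow_zero, pow_one] at p0 p1
    have hPκ : X ^ 6 ≤ X ^ 6 * κ := Nat.le_mul_of_pos_right _ (by omega)
    have hP : X ^ 6 * κ ≤ (X ^ 6) ^ 2 * κ :=
      Nat.mul_le_mul_right _ (Nat.le_self_pow (by norm_num) _)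
    have hκP : κ ≤ X ^ 6 * κ := Nat.le_mul_of_pos_left _ (by omega)
    have hW : width k K G ≤ 8 * X ^ 6 * κ :=
      width_le.trans (Nat.mul_le_mul_right _ (Nat.mul_le_mul_left _ p5))
    obtain ⟨s₁, t₁, he₁, ⟨hs₁, h5⟩, hb₁⟩ := setup_runs (k := k) (G := G) (F := F)
    obtain ⟨s₂, t₂, he₂, hs₂, ht₂⟩ := search_exec hF (visits K G) s₁ hs₁ (by rw [h5, zero_add])
    rw [← hK] at ht₂
    obtain ⟨s₃, t₃, he₃, hs₃, hb₃⟩ := answer_runs hF hs₂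
    have hlay : Layout k K G F s₂ := by
      rcases hs₂ with h | h
      exacts [h.toLayout, h.1]
    have ht₁ := (hb₁ _ input_bdd).1
    have ht₃ := (hb₃ _ hlay.bdd).1
    refine ⟨s₃, _, .ite_ne (P := setup ;; .loop 7 visit ;; answer) (show n ≠ 0 by omega)
      (he₁.seq (he₂.seq he₃)), hs₃, ?_⟩
    have b₁ : t₁ ≤ 83800 * ((X ^ 6) ^ 2 * κ) := by
      refine ht₁.trans (mul_cost_le ?_ ?_ p0 (by omega))
      · have : n * (n + 10) + 2 * n + 40 ≤ X * (X + 10) + 2 * X + 40 := by gcongr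
        refine this.trans ?_
        ring_nf at p0 p1 p2 p3 p4 p5 ⊢
        omega
      · have := size_le_self n
        have h8 : 8 * X ^ 6 * κ = 8 * (X ^ 6 * κ) := by ring
        omega
    have b₃ : t₃ ≤ 83800 * ((X ^ 6) ^ 2 * κ) := by
      refine ht₃.trans (mul_cost_le ?_ hW p0 (by omega))
      have : n * (K * (K + n + 10) + 6) + n * K + 10 ≤
          X * (X ^ 2 * (X ^ 2 + X + 10) + 6) + X * X ^ 2 + 10 := by gcongr
      refine this.trans ?_
      ring_nf at p0 p1 p2 p3 p4 p5 ⊢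
      omega
    have b₂ : t₂ ≤ (visits K G + 1) * (83818 * ((X ^ 6) ^ 2 * κ)) := by
      refine ht₂.trans (Nat.mul_le_mul_left _ ?_)
      have := mul_cost_le (visitWeight_le hX.symm hK2) hW p0 (show 1 ≤ κ by omega)
      have h8 : 8 * X ^ 6 * κ = 8 * (X ^ 6 * κ) := by ring
      omega
    have hv : 1 ≤ visits K G := treeSize_pos _ _
    have b₀ : 1 + ((input G k F).reg 0).size ≤ (X ^ 6) ^ 2 * κ := by
      have : (input G k F).reg 0 = n := rfl
      rw [this]
      have := size_le_self n
      omega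
    set Y := (X ^ 6) ^ 2 * κ with hY
    have hYv : Y ≤ visits K G * Y := Nat.le_mul_of_pos_left _ hv
    calc 1 + ((input G k F).reg 0).size + (t₁ + (t₂ + t₃))
        ≤ Y + (83800 * Y + ((visits K G + 1) * (83818 * Y) + 83800 * Y)) := by gcongr
      _ ≤ 335237 * (visits K G * Y) := by nlinarith
      _ = 335237 * X ^ 12 * (visits K G * κ) := by rw [hY]; ring
      _ ≤ 335237 * X ^ 12 * (3 * k ^ (G.indepNum * k) * X ^ 5) :=
        Nat.mul_le_mul_left _ (visits_mul_size_le (by omega))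
      _ = 1005711 * (k ^ (G.indepNum * k) * X ^ 17) := by ring
      _ ≤ 1100000 * (k ^ (G.indepNum * k) * X ^ 17) := Nat.mul_le_mul_right _ (by norm_num)
      _ = _ := by ring

theorem two_rpow_mul_logb (a k : ℕ) :
    (2 : ℝ) ^ ((a : ℝ) * k * Real.logb 2 k) = (k : ℝ) ^ (a * k) := by
  rcases Nat.eq_zero_or_pos k with rfl | hk
  -- For `k = 0` both sides are `1`.
  · simp
  · have hk' : (0 : ℝ) < k := by exact_mod_cast hk
    rw [mul_comm, Real.rpow_mul (by norm_num), Real.rpow_logb (by norm_num) (by norm_num) hk',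
      ← Nat.cast_mul, Real.rpow_natCast]

end PMC

theorem corollary2 :
    ∃ (P : RAM.Program) (C : ℕ),
      ∀ (n k : ℕ) (G : SimpleGraph (Fin n)) (F : Set (Sym2 (Fin n))), F ⊆ Gᶜ.edgeSet →
        ∃ (s : RAM.State) (t : ℕ),
          RAM.Exec P (PMC.input G k F) s t ∧
          PMC.IsAnswer G k F s ∧
          (t : ℝ) ≤ C * (2 : ℝ) ^ ((G.indepNum : ℝ) * k * Real.logb 2 k) * ((n : ℝ) + 1) ^ C := by
  -- One constant serves as factor and as exponent; keeping it opaque prevents the huge power from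
  -- being evaluated.
  obtain ⟨C, hC, hC'⟩ : ∃ C : ℕ, 1100000 ≤ C ∧ 17 ≤ C := ⟨1100000, le_rfl, by norm_num⟩
  refine ⟨PMC.solve, C, fun n k G F hF => ?_⟩
  obtain ⟨s, t, he, hs, ht⟩ := PMC.solve_correct (k := k) hF
  refine ⟨s, t, he, hs, ?_⟩
  rw [PMC.two_rpow_mul_logb]
  have h : t ≤ C * k ^ (G.indepNum * k) * (n + 1) ^ C :=
    ht.trans (Nat.mul_le_mul (Nat.mul_le_mul_right _ hC) (Nat.pow_le_pow_right (by omega) hC'))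
  exact_mod_cast h
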